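/- Let $n,N\ge 1$. Let $\Delta_n$ be the equioriented cycle quiver, with vertex set $\mathbb Z/n\mathbb Z$ and one arrow $i\to i+1$ for each $i$. Let $M$ be a finite-dimensional complex representation of $\Delta_n$, with spaces $M^{(i)}$ and maps $M_i:M^{(i)}\to M^{(i+1)}$, that is $N$-nilpotent, i.e. every composition of $N$ consecutive maps $M_i$ vanishes. For a dimension vector $\mathbf e\in\mathbb N^{\mathbb Z/n\mathbb Z}$ let $\mathrm{Gr}_{\mathbf e}(M)\subseteq\prod_i \mathrm{Gr}_{e_i}(M^{(i)})$ be the quiver Grassmannian, the closed subvariety of subrepresentations of dimension vector $\mathbf e$, and let $\mathrm{gsub}_{\mathbf e}(M)$ be the set of isomorphism classes $[R]$ for which the stratum $\{U\in\mathrm{Gr}_{\mathbf e}(M): U\cong R\}$ is nonempty and Zariski open in $\mathrm{Gr}_{\mathbf e}(M)$. Let $\hat\Delta_{n,N}$ be the quiver with vertices $(i,k)$, $i\in\mathbb Z/n\mathbb Z$, $1\le k\le N$, and with arrows $\alpha_{i,k}:(i,k)\to(i,k+1)$ for $1\le k\le N-1$ and $\beta_{i,k}:(i,k)\to(i+1,k-1)$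 for $2\le k\le N$. For a representation $L$ of $\Delta_n$ let $\hat L$ be the representation of $\hat\Delta_{n,N}$ with $\hat L^{(i,1)}=L^{(i)}$ and $\hat L^{(i,k)}=L_{i+k-2}\circ\cdots\circ L_{i+1}\circ L_i(L^{(i)})\subseteq L^{(i+k-1)}$ for $k\ge2$, where $\alpha_{i,k}$ acts by $L_{i+k-1}$ and $\beta_{i,k}$ acts by the inclusion $\hat L^{(i,k)}\hookrightarrow\hat L^{(i+1,k-1)}$. Let $[R]\in\mathrm{gsub}_{\mathbf e}(M)$, and put $\hat{\mathbf m}=\mathbf{dim}\,\hat M$ and $\hat{\mathbf r}=\mathbf{dim}\,\hat R$. Then there are projective complex varieties $X_1,\dots,X_N$ (not necessarily irreducible) and morphisms $$\mathrm{Gr}_{\mathbf{dim}\,\hat R}(\hat M)\cong X_1\to X_2\to\cdots\to X_N\cong\prod_{i\in\mathbb Z/n\mathbb Z}\mathrm{Gr}_{\hat r^{(i,N)}}\bigl(\mathbb C^{\hat m^{(i,N)}}\bigr)$$ such that for each $1\le k\le N-1$ the morphism $X_k\to X_{k+1}$ is a Zariski-locally trivial fibration with fibre isomorphic to a product of ordinary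 Grassmannians $\prod_{i\in\mathbb Z/n\mathbb Z}\mathrm{Gr}_{a_{i,k}}(\mathbb C^{b_{i,k}})$ for some integers $0\le a_{i,k}\le b_{i,k}$. -/

import Mathlib

universe u v w

/-! ## Complex varieties as spaces with functions -/

/-- The structure of a (complex) space with functions on a set `X`: a topology, and for every open
set `U` a `ℂ`-algebra of regular functions on `U`, such that regularity is a local property, and
such that the non-vanishing locus `D(f)` of a regular function `f` is open with `1 / f` regular on
`D(f)`. A function on `U` is represented by a function on `X`, whose values outside `U` are
irrelevant (`regular_congr`). -/
structure FunctionStructure (X : Type u) extends TopologicalSpace X where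
  /-- `Regular U f`: the set `U` is open and the restriction of `f` to `U` is regular. -/
  Regular : Set X → (X → ℂ) → Prop
  isOpen_of_regular : ∀ {U f}, Regular U f → IsOpen U
  regular_congr : ∀ {U f g}, Regular U f → Set.EqOn f g U → Regular U g
  regular_mono : ∀ {U V f}, Regular U f → IsOpen V → V ⊆ U → Regular V f
  regular_of_locally : ∀ {U f}, (∀ x ∈ U, ∃ V ⊆ U, x ∈ V ∧ Regular V f) → Regular U f
  regular_const : ∀ {U} (c : ℂ), IsOpen U → Regular U (fun _ => c)
  regular_add : ∀ {U f g}, Regular U f → Regular U g → Regular U (fun x => f x + g x)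
  regular_mul : ∀ {U f g}, Regular U f → Regular U g → Regular U (fun x => f x * g x)
  isOpen_ne_zero : ∀ {U f}, Regular U f → IsOpen {x ∈ U | f x ≠ 0}
  regular_inv : ∀ {U f}, Regular U f → Regular {x ∈ U | f x ≠ 0} (fun x => (f x)⁻¹)

namespace FunctionStructure

/-- Morphisms of spaces with functions: continuous maps that pull back regular functions to
regular functions. -/
def IsMorphism {X : Type u} {Y : Type v} (s : FunctionStructure X) (t : FunctionStructure Y)
    (φ : X → Y) : Prop :=
  (∀ U, t.IsOpen U → s.IsOpen (φ ⁻¹' U)) ∧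
    ∀ U f, t.Regular U f → s.Regular (φ ⁻¹' U) (f ∘ φ)

/-- The coarsest structure of a space with functions on `X` (fewest open sets, fewest regular
functions) with a property `P`: the intersection of all structures with this property. It is used
for properties "given maps out of `X` are morphisms", which are stable under intersections. -/
def coarsest {X : Type u} (P : FunctionStructure X → Prop) : FunctionStructure X where
  IsOpen U := ∀ s : FunctionStructure X, P s → s.IsOpen U
  isOpen_univ s _ := s.isOpen_univ
  isOpen_inter U V hU hV s hs := s.isOpen_inter U V (hU s hs) (hV s hs)
  isOpen_sUnion S hS s hs := s.isOpen_sUnion S fun U hU => hS U hU s hs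
  Regular U f := ∀ s : FunctionStructure X, P s → s.Regular U f
  isOpen_of_regular h s hs := s.isOpen_of_regular (h s hs)
  regular_congr h hfg s hs := s.regular_congr (h s hs) hfg
  regular_mono h hV hVU s hs := s.regular_mono (h s hs) (hV s hs) hVU
  regular_of_locally h s hs := s.regular_of_locally fun x hx =>
    let ⟨V, hVU, hxV, hV⟩ := h x hx
    ⟨V, hVU, hxV, hV s hs⟩
  regular_const c hU s hs := s.regular_const c (hU s hs)
  regular_add hf hg s hs := s.regular_add (hf s hs) (hg s hs)
  regular_mul hf hg s hs := s.regular_mul (hf s hs) (hg s hs)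
  isOpen_ne_zero h s hs := s.isOpen_ne_zero (h s hs)
  regular_inv h s hs := s.regular_inv (h s hs)

/-- The quotient structure along a map `π : X → Y`: a set is open if its preimage is open, a
function is regular if its pullback is regular. -/
def quotient {X : Type u} {Y : Type v} (s : FunctionStructure X) (π : X → Y) :
    FunctionStructure Y where
  IsOpen U := s.IsOpen (π ⁻¹' U)
  isOpen_univ := s.isOpen_univ
  isOpen_inter _ _ hU hV := s.isOpen_inter _ _ hU hV
  isOpen_sUnion S hS := by
    have h : π ⁻¹' (⋃₀ S) = ⋃₀ ((fun U => π ⁻¹' U) '' S) := by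
      ext x; simp
    rw [h]
    refine s.isOpen_sUnion _ ?_
    rintro _ ⟨U, hU, rfl⟩
    exact hS U hU
  Regular U f := s.Regular (π ⁻¹' U) (f ∘ π)
  isOpen_of_regular h := s.isOpen_of_regular h
  regular_congr h hfg := s.regular_congr h fun _ hx => hfg hx
  regular_mono h hV hVU := s.regular_mono h hV fun _ hx => hVU hx
  regular_of_locally h := s.regular_of_locally fun x hx =>
    let ⟨V, hVU, hxV, hV⟩ := h (π x) hx
    ⟨π ⁻¹' V, fun _ hy => hVU hy, hxV, hV⟩
  regular_const c hU := s.regular_const c hU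
  regular_add hf hg := s.regular_add hf hg
  regular_mul hf hg := s.regular_mul hf hg
  isOpen_ne_zero h := s.isOpen_ne_zero h
  regular_inv h := s.regular_inv h

/-- The polynomial functions on a complex vector space: the algebra of functions generated by the
linear functionals. -/
def polynomialFunctions (W : Type u) [AddCommGroup W] [Module ℂ W] : Subalgebra ℂ (W → ℂ) :=
  Algebra.adjoin ℂ (Set.range fun φ : Module.Dual ℂ W => (φ : W → ℂ))

/-- A complex vector space as an affine space: the Zariski topology, with basis the sets
`D(q)` for polynomial functions `q`; regular functions are locally quotients `p / q` of polynomial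
functions. -/
def affine (W : Type u) [AddCommGroup W] [Module ℂ W] : FunctionStructure W where
  IsOpen U := ∀ x ∈ U, ∃ q ∈ polynomialFunctions W, q x ≠ 0 ∧ ∀ y, q y ≠ 0 → y ∈ U
  isOpen_univ _ _ := ⟨1, one_mem _, by simp, fun _ _ => trivial⟩
  isOpen_inter U V hU hV x hx := by
    obtain ⟨q, hq, hqx, hqU⟩ := hU x hx.1
    obtain ⟨r, hr, hrx, hrV⟩ := hV x hx.2
    refine ⟨q * r, mul_mem hq hr, mul_ne_zero hqx hrx, fun y hy => ?_⟩
    exact ⟨hqU y (left_ne_zero_of_mul hy), hrV y (right_ne_zero_of_mul hy)⟩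
  isOpen_sUnion S hS := by
    rintro x ⟨U, hU, hx⟩
    obtain ⟨q, hq, hqx, hqU⟩ := hS U hU x hx
    exact ⟨q, hq, hqx, fun y hy => ⟨U, hU, hqU y hy⟩⟩
  Regular U f :=
    (∀ x ∈ U, ∃ q ∈ polynomialFunctions W, q x ≠ 0 ∧ ∀ y, q y ≠ 0 → y ∈ U) ∧
    ∀ x ∈ U, ∃ p ∈ polynomialFunctions W, ∃ q ∈ polynomialFunctions W,
      q x ≠ 0 ∧ ∀ y ∈ U, q y ≠ 0 → f y = p y / q y
  isOpen_of_regular h := h.1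
  regular_congr {U f g} h hfg := by
    refine ⟨h.1, fun x hx => ?_⟩
    obtain ⟨p, hp, q, hq, hqx, hpq⟩ := h.2 x hx
    exact ⟨p, hp, q, hq, hqx, fun y hy hqy => (hfg hy).symm.trans (hpq y hy hqy)⟩
  regular_mono {U V f} h hV hVU := by
    refine ⟨hV, fun x hx => ?_⟩
    obtain ⟨p, hp, q, hq, hqx, hpq⟩ := h.2 x (hVU hx)
    exact ⟨p, hp, q, hq, hqx, fun y hy hqy => hpq y (hVU hy) hqy⟩
  regular_of_locally {U f} h := by
    refine ⟨fun x hx => ?_, fun x hx => ?_⟩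
    · obtain ⟨V, hVU, hxV, hV⟩ := h x hx
      obtain ⟨q, hq, hqx, hqV⟩ := hV.1 x hxV
      exact ⟨q, hq, hqx, fun y hy => hVU (hqV y hy)⟩
    · obtain ⟨V, hVU, hxV, hV⟩ := h x hx
      obtain ⟨r, hr, hrx, hrV⟩ := hV.1 x hxV
      obtain ⟨p, hp, q, hq, hqx, hpq⟩ := hV.2 x hxV
      refine ⟨p * r, mul_mem hp hr, q * r, mul_mem hq hr, mul_ne_zero hqx hrx, ?_⟩
      intro y _ hy
      have h1 : q y ≠ 0 := left_ne_zero_of_mul hy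
      have h2 : r y ≠ 0 := right_ne_zero_of_mul hy
      rw [hpq y (hrV y h2) h1]
      simp only [Pi.mul_apply]
      field_simp
  regular_const {U} c hU := by
    refine ⟨hU, fun x _ => ⟨algebraMap ℂ (W → ℂ) c, Subalgebra.algebraMap_mem _ c, 1, one_mem _,
      by simp, fun y _ _ => by simp⟩⟩
  regular_add {U f g} hf hg := by
    refine ⟨hf.1, fun x hx => ?_⟩
    obtain ⟨p, hp, q, hq, hqx, hpq⟩ := hf.2 x hx
    obtain ⟨p', hp', q', hq', hqx', hpq'⟩ := hg.2 x hx
    refine ⟨p * q' + p' * q, add_mem (mul_mem hp hq') (mul_mem hp' hq), q * q', mul_mem hq hq',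
      mul_ne_zero hqx hqx', fun y hy hqy => ?_⟩
    have h1 : q y ≠ 0 := left_ne_zero_of_mul hqy
    have h2 : q' y ≠ 0 := right_ne_zero_of_mul hqy
    beta_reduce
    rw [hpq y hy h1, hpq' y hy h2]
    simp only [Pi.mul_apply, Pi.add_apply]
    field_simp
  regular_mul {U f g} hf hg := by
    refine ⟨hf.1, fun x hx => ?_⟩
    obtain ⟨p, hp, q, hq, hqx, hpq⟩ := hf.2 x hx
    obtain ⟨p', hp', q', hq', hqx', hpq'⟩ := hg.2 x hx
    refine ⟨p * p', mul_mem hp hp', q * q', mul_mem hq hq',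
      mul_ne_zero hqx hqx', fun y hy hqy => ?_⟩
    have h1 : q y ≠ 0 := left_ne_zero_of_mul hqy
    have h2 : q' y ≠ 0 := right_ne_zero_of_mul hqy
    beta_reduce
    rw [hpq y hy h1, hpq' y hy h2]
    simp only [Pi.mul_apply]
    field_simp
  isOpen_ne_zero {U f} h := by
    rintro x ⟨hx, hfx⟩
    obtain ⟨r, hr, hrx, hrU⟩ := h.1 x hx
    obtain ⟨p, hp, q, hq, hqx, hpq⟩ := h.2 x hx
    have hpx : p x ≠ 0 := fun h0 => hfx (by rw [hpq x hx hqx, h0, zero_div])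
    refine ⟨p * q * r, mul_mem (mul_mem hp hq) hr,
      mul_ne_zero (mul_ne_zero hpx hqx) hrx, fun y hy => ?_⟩
    have h1 := left_ne_zero_of_mul hy
    have hyU := hrU y (right_ne_zero_of_mul hy)
    refine ⟨hyU, ?_⟩
    rw [hpq y hyU (right_ne_zero_of_mul h1)]
    exact div_ne_zero (left_ne_zero_of_mul h1) (right_ne_zero_of_mul h1)
  regular_inv {U f} h := by
    refine ⟨?_, ?_⟩
    · rintro x ⟨hx, hfx⟩
      obtain ⟨r, hr, hrx, hrU⟩ := h.1 x hx
      obtain ⟨p, hp, q, hq, hqx, hpq⟩ := h.2 x hx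
      have hpx : p x ≠ 0 := fun h0 => hfx (by rw [hpq x hx hqx, h0, zero_div])
      refine ⟨p * q * r, mul_mem (mul_mem hp hq) hr,
        mul_ne_zero (mul_ne_zero hpx hqx) hrx, fun y hy => ?_⟩
      have h1 := left_ne_zero_of_mul hy
      have hyU := hrU y (right_ne_zero_of_mul hy)
      refine ⟨hyU, ?_⟩
      rw [hpq y hyU (right_ne_zero_of_mul h1)]
      exact div_ne_zero (left_ne_zero_of_mul h1) (right_ne_zero_of_mul h1)
    · rintro x ⟨hx, hfx⟩
      obtain ⟨p, hp, q, hq, hqx, hpq⟩ := h.2 x hx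
      have hpx : p x ≠ 0 := fun h0 => hfx (by rw [hpq x hx hqx, h0, zero_div])
      refine ⟨q * q, mul_mem hq hq, p * q, mul_mem hp hq, mul_ne_zero hpx hqx, ?_⟩
      rintro y ⟨hyU, _⟩ hpqy
      have h1 : p y ≠ 0 := left_ne_zero_of_mul hpqy
      have h2 : q y ≠ 0 := right_ne_zero_of_mul hpqy
      beta_reduce
      rw [hpq y hyU h2]
      simp only [Pi.mul_apply]
      field_simp

end FunctionStructure

/-- A (complex) space with functions. -/
structure SpaceWithFunctions where
  carrier : Type u
  str : FunctionStructure carrier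

namespace SpaceWithFunctions

instance : CoeSort SpaceWithFunctions.{u} (Type u) := ⟨carrier⟩

/-- An isomorphism of spaces with functions. -/
structure Iso (X : SpaceWithFunctions.{u}) (Y : SpaceWithFunctions.{v}) extends X ≃ Y where
  isMorphism_toFun : X.str.IsMorphism Y.str toFun
  isMorphism_invFun : Y.str.IsMorphism X.str invFun

/-- A subset with the induced structure, the coarsest one for which the inclusion is a morphism:
the topology is the subspace topology, and the regular functions are those that extend locally to
regular functions on the ambient space. -/
def sub (X : SpaceWithFunctions.{u}) (S : Set X) : SpaceWithFunctions.{u} where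
  carrier := S
  str := FunctionStructure.coarsest fun s => s.IsMorphism X.str Subtype.val

/-- The (categorical) product of two spaces with functions: the coarsest structure for which the
projections are morphisms. -/
def prod (X : SpaceWithFunctions.{u}) (Y : SpaceWithFunctions.{v}) :
    SpaceWithFunctions.{max u v} where
  carrier := X × Y
  str := FunctionStructure.coarsest fun s =>
    s.IsMorphism X.str Prod.fst ∧ s.IsMorphism Y.str Prod.snd

/-- The (categorical) product of a family of spaces with functions: the coarsest structure for which
the projections are morphisms. -/
def pi {J : Type w} (X : J → SpaceWithFunctions.{u}) : SpaceWithFunctions.{max w u} where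
  carrier := ∀ j, X j
  str := FunctionStructure.coarsest fun s => ∀ j, s.IsMorphism (X j).str fun z => z j

/-- The variety of `e`-frames (linearly independent `e`-tuples) of `V`, as a subset of the affine
space `V ^ e`. -/
def frames (V : Type u) [AddCommGroup V] [Module ℂ V] (e : ℕ) : SpaceWithFunctions.{u} :=
  sub ⟨Fin e → V, FunctionStructure.affine (Fin e → V)⟩ {F | LinearIndependent ℂ F}

/-- The Grassmannian of `e`-dimensional subspaces of a finite-dimensional space `V`, as the
(geometric) quotient of the variety of `e`-frames of `V` by `GL_e`, the quotient map sending a frame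
to its span. -/
def grassmannian (V : Type u) [AddCommGroup V] [Module ℂ V] (e : ℕ) : SpaceWithFunctions.{u} where
  carrier := {U : Submodule ℂ V // Module.finrank ℂ U = e}
  str := (frames V e).str.quotient fun F =>
    ⟨Submodule.span ℂ (Set.range F.1), by
      rw [finrank_span_eq_card F.2, Fintype.card_fin]⟩

/-- Projective varieties (not necessarily irreducible): the spaces isomorphic to a Zariski closed
subset of a finite product of Grassmannians. As projective spaces are Grassmannians, and finite
products of Grassmannians are closed in projective spaces, these are exactly the spaces isomorphic
to a closed subset of a projective space. -/
def IsProjectiveVariety (X : SpaceWithFunctions.{u}) : Prop :=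
  ∃ (t : ℕ) (d e : Fin t → ℕ) (Z : Set (pi fun j => grassmannian (Fin (d j) → ℂ) (e j))),
    (pi fun j => grassmannian (Fin (d j) → ℂ) (e j)).str.IsOpen Zᶜ ∧
      Nonempty (Iso X (sub _ Z))

/-- `p : X → Y` is a Zariski-locally trivial fibration with fibre `F`: every point of `Y` has an
open neighbourhood `W` such that `p ⁻¹ W` is isomorphic to `W × F` over `W`. -/
def IsFibration {X : SpaceWithFunctions.{u}} {Y : SpaceWithFunctions.{v}} (p : X → Y)
    (F : SpaceWithFunctions.{w}) : Prop :=
  X.str.IsMorphism Y.str p ∧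
    ∀ y : Y, ∃ W : Set Y, Y.str.IsOpen W ∧ y ∈ W ∧
      ∃ φ : Iso (X.sub (p ⁻¹' W)) ((Y.sub W).prod F), ∀ x, (φ.toFun x).1.1 = p x.1

end SpaceWithFunctions

/-! ## Quiver representations and quiver Grassmannians -/

/-- Finite-dimensional complex representations of a quiver. -/
structure QuiverRep (Q : Type v) [Quiver.{w} Q] where
  V : Q → Type u
  [addCommGroup : ∀ i, AddCommGroup (V i)]
  [module : ∀ i, Module ℂ (V i)]
  [finiteDimensional : ∀ i, FiniteDimensional ℂ (V i)]
  map : ∀ {i j : Q}, (i ⟶ j) → V i →ₗ[ℂ] V j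

attribute [instance] QuiverRep.addCommGroup QuiverRep.module QuiverRep.finiteDimensional

namespace QuiverRep

variable {Q : Type v} [Quiver.{w} Q]

/-- The dimension vector. -/
noncomputable def dim (M : QuiverRep.{u} Q) (i : Q) : ℕ := Module.finrank ℂ (M.V i)

/-- The composition of the maps of a representation along a path. -/
def pathMap (M : QuiverRep.{u} Q) {i : Q} : ∀ {j : Q}, Quiver.Path i j → (M.V i →ₗ[ℂ] M.V j)
  | _, .nil => LinearMap.id
  | _, .cons p a => M.map a ∘ₗ M.pathMap p

/-- Isomorphic representations. -/
def IsIsomorphic (M N : QuiverRep.{u} Q) : Prop :=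
  ∃ φ : ∀ i, M.V i ≃ₗ[ℂ] N.V i,
    ∀ (i j : Q) (a : i ⟶ j) (x : M.V i), φ j (M.map a x) = N.map a (φ i x)

/-- The quiver Grassmannian `Gr_e(M)`: the subset of the product of the Grassmannians
`Gr_{e_i}(M^{(i)})` formed by the subrepresentations, with the induced structure. -/
def grassmannian (M : QuiverRep.{u} Q) (e : Q → ℕ) : SpaceWithFunctions.{max u v} :=
  SpaceWithFunctions.sub (SpaceWithFunctions.pi fun i => SpaceWithFunctions.grassmannian (M.V i) (e i))
    {U | ∀ (i j : Q) (a : i ⟶ j), ∀ x ∈ (U i).1, M.map a x ∈ (U j).1}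

/-- A point of the quiver Grassmannian, as a representation. -/
def subrep (M : QuiverRep.{u} Q) (e : Q → ℕ) (U : M.grassmannian e) : QuiverRep.{u} Q where
  V i := (U.1 i).1
  map {i j} a := (M.map a).restrict (U.2 i j a)

/-- The stratum of the isomorphism class of `R` in `Gr_e(M)`. -/
def stratum (M : QuiverRep.{u} Q) (e : Q → ℕ) (R : QuiverRep.{u} Q) : Set (M.grassmannian e) :=
  {U | (M.subrep e U).IsIsomorphic R}

/-- The isomorphism class of `R` is a generic subrepresentation type of `M` of dimension vector
`e`, i.e. `[R] ∈ gsub_e(M)`: it occurs among the subrepresentations in `Gr_e(M)`, and its stratum is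
open in `Gr_e(M)`. -/
def IsGenericSubrepType (M : QuiverRep.{u} Q) (e : Q → ℕ) (R : QuiverRep.{u} Q) : Prop :=
  (M.stratum e R).Nonempty ∧ (M.grassmannian e).str.IsOpen (M.stratum e R)

/-- The identification of the spaces of a representation at two equal vertices. -/
def idMap (M : QuiverRep.{u} Q) {i j : Q} (h : i = j) : M.V i →ₗ[ℂ] M.V j :=
  h ▸ LinearMap.id

end QuiverRep

/-! ## The equioriented cycle and the equioriented cylinder -/

/-- The vertices of the equioriented cycle quiver `Δ_n`. -/
def CycleQuiver (n : ℕ) : Type := ZMod n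

instance (n : ℕ) : CommRing (CycleQuiver n) := inferInstanceAs (CommRing (ZMod n))

/-- The cycle has exactly one arrow `i → i + 1` for every vertex `i`. -/
instance (n : ℕ) : Quiver.{0} (CycleQuiver n) where
  Hom i j := PLift (j = i + 1)

namespace CycleQuiver

variable {n : ℕ}

/-- The arrow `i → i + 1`. -/
def arrow (i : CycleQuiver n) : i ⟶ i + 1 := ⟨rfl⟩

/-- The vertex `i + k`, reached from `i` after `k` steps. -/
def shift (i : CycleQuiver n) : ℕ → CycleQuiver n
  | 0 => i
  | k + 1 => shift i k + 1

/-- The path of length `k` starting at `i`. -/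
def path (i : CycleQuiver n) : ∀ k : ℕ, Quiver.Path i (shift i k)
  | 0 => .nil
  | k + 1 => .cons (path i k) (arrow (shift i k))

theorem shift_succ (i : CycleQuiver n) (k : ℕ) : shift i (k + 1) = shift (i + 1) k := by
  induction k with
  | zero => rfl
  | succ k ih => exact congrArg (· + 1) ih

end CycleQuiver

/-- The vertices of the equioriented cylinder quiver. The pair `(i, k)` with `k : Fin N`, that is
`0 ≤ k ≤ N - 1`, is the `i`-th vertex of the layer of height `k + 1`. -/
def CylinderQuiver (n N : ℕ) : Type := CycleQuiver n × Fin N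

/-- The arrows of the cylinder: `α` goes from `(i, k)` to `(i, k + 1)`, and `β` goes from
`(i, k + 1)` to `(i + 1, k)`. -/
inductive CylinderQuiver.Arrow (n N : ℕ) : CylinderQuiver n N → CylinderQuiver n N → Type
  | α (i : CycleQuiver n) (k : ℕ) (h : k + 1 < N) :
      CylinderQuiver.Arrow n N (i, ⟨k, k.lt_succ_self.trans h⟩) (i, ⟨k + 1, h⟩)
  | β (i : CycleQuiver n) (k : ℕ) (h : k + 1 < N) :
      CylinderQuiver.Arrow n N (i, ⟨k + 1, h⟩) (i + 1, ⟨k, k.lt_succ_self.trans h⟩)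

instance (n N : ℕ) : Quiver.{0} (CylinderQuiver n N) where
  Hom := CylinderQuiver.Arrow n N

namespace QuiverRep

variable {n : ℕ}

/-- `N`-nilpotent representations of the cycle: all compositions along `N` consecutive arrows
vanish. -/
def IsNilpotent (M : QuiverRep.{u} (CycleQuiver n)) (N : ℕ) : Prop :=
  ∀ (i j : CycleQuiver n) (p : Quiver.Path i j), p.length = N → M.pathMap p = 0

theorem idMap_map_arrow (M : QuiverRep.{u} (CycleQuiver n)) {i j : CycleQuiver n} (h : i = j)
    (h' : i + 1 = j + 1) (x : M.V i) :
    M.idMap h' (M.map (CycleQuiver.arrow i) x) = M.map (CycleQuiver.arrow j) (M.idMap h x) := by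
  subst h; rfl

theorem idMap_pathMap_succ (M : QuiverRep.{u} (CycleQuiver n)) (i : CycleQuiver n) (k : ℕ)
    (x : M.V i) :
    M.idMap (CycleQuiver.shift_succ i k) (M.pathMap (CycleQuiver.path i (k + 1)) x) =
      M.pathMap (CycleQuiver.path (i + 1) k) (M.map (CycleQuiver.arrow i) x) := by
  induction k with
  | zero => rfl
  | succ k ih =>
    change M.idMap _ (M.map (CycleQuiver.arrow _) (M.pathMap (CycleQuiver.path i (k + 1)) x)) =
      M.map (CycleQuiver.arrow _) (M.pathMap (CycleQuiver.path (i + 1) k) _)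
    rw [← ih]
    exact M.idMap_map_arrow (CycleQuiver.shift_succ i k) _ _

/-- The representation `Λ(M) = M̂` of the cylinder. The space at the vertex `(i, k)` is the image of
`M^{(i)}` in `M^{(i + k)}` under the composition of `k` consecutive maps of `M` (recall that `k` is
counted from `0`); the arrows `α` act by the maps of `M`, and the arrows `β` by the inclusions. -/
def hat (N : ℕ) (M : QuiverRep.{u} (CycleQuiver n)) : QuiverRep.{u} (CylinderQuiver n N) where
  V v := LinearMap.range (M.pathMap (CycleQuiver.path v.1 v.2.1))
  map a := match a with
    | .α i k _ => (M.map (CycleQuiver.arrow (CycleQuiver.shift i k))).restrict (by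
        rintro _ ⟨x, rfl⟩
        exact ⟨x, rfl⟩)
    | .β i k _ => (M.idMap (CycleQuiver.shift_succ i k)).restrict (by
        rintro _ ⟨x, rfl⟩
        exact ⟨M.map (CycleQuiver.arrow i) x, (M.idMap_pathMap_succ i k x).symm⟩)

end QuiverRep

/-!
A point of the quiver Grassmannian of `M̂` is a family of subspaces `U (i, k)` with
`α (U (i, k)) ⊆ U (i, k + 1)` and `β (U (i, k + 1)) ⊆ U (i + 1, k)`. Let `X_k` be the space of such
families on the layers of height at least `k` (`QuiverRep.truncatedGrassmannian`), and let
`X_k → X_(k + 1)` forget the lowest layer. Over a given point of `X_(k + 1)`, the subspace at the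
vertex `(i + 1, k)` can be chosen freely, and independently for all `i`, subject to
`β (U (i, k + 1)) ⊆ U (i + 1, k) ⊆ α⁻¹ (U (i + 1, k + 1))`.
The lower bound lies in the upper one, because `α β = β α` below the top layer, while `α β = 0` at
the top layer by nilpotency (`QuiverRep.hat_up_down`). Their dimensions are constant, because the
maps `β` of `M̂` are injective and the maps `α` are surjective. Hence the fibre is a product of
Grassmannians of the quotients of the two bounds. That the dimension of `U (i + 1, k)` lies between
those of the bounds follows from an embedding of `R` into `M` (`QuiverRep.hat_dim_down_le`,
`QuiverRep.hat_dim_le_up`). In the top layer there are no conditions, so the last space is a product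
of Grassmannians.

Local triviality (`SpaceWithFunctions.isFibration_of_flags`) rests on a description of morphisms to
Grassmannians: a map to a Grassmannian is a morphism if and only if its values are locally spanned
by regular vector valued functions (`SpaceWithFunctions.isMorphism_grassmannian`,
`SpaceWithFunctions.exists_regularVec_frame`). In particular two nested families of subspaces have
regular frames near a given point, and moving these frames defines a regular family of automorphisms
of the ambient space that carries the pair of subspaces at this point to the nearby pairs
(`SpaceWithFunctions.exists_flag_trivialization`). The same description shows that containment
conditions are closed (`SpaceWithFunctions.isOpen_compl_map_le`), hence that all `X_k` are
projective.
-/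

/-! ### Morphisms of spaces with functions -/

namespace FunctionStructure

variable {X : Type u} {Y : Type v} {Z : Type w} {s : FunctionStructure X}
  {t : FunctionStructure Y} {r : FunctionStructure Z}

theorem IsMorphism.id : s.IsMorphism s id :=
  ⟨fun _ h => h, fun _ _ h => h⟩

theorem IsMorphism.comp {φ : X → Y} {ψ : Y → Z} (hψ : t.IsMorphism r ψ) (hφ : s.IsMorphism t φ) :
    s.IsMorphism r (ψ ∘ φ) :=
  ⟨fun _ h => hφ.1 _ (hψ.1 _ h), fun _ _ h => hφ.2 _ _ (hψ.2 _ _ h)⟩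

/-- The universal property of a coarsest structure. As `IsMorphism (s.quotient φ) r ψ` unfolds to
`IsMorphism s r (ψ ∘ φ)`, it contains the universal properties of subspaces and products. -/
theorem isMorphism_coarsest {P : FunctionStructure Y → Prop} {φ : X → Y} (h : P (s.quotient φ)) :
    s.IsMorphism (coarsest P) φ :=
  ⟨fun _ hU => hU _ h, fun _ _ hf => hf _ h⟩

theorem coarsest_isMorphism {P : FunctionStructure X → Prop} {φ : X → Y}
    (h : ∀ s, P s → s.IsMorphism t φ) : (coarsest P).IsMorphism t φ :=
  ⟨fun _ hU s hs => (h s hs).1 _ hU, fun _ _ hf s hs => (h s hs).2 _ _ hf⟩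

theorem isOpen_of_locally {U : Set X} (h : ∀ x ∈ U, ∃ V ⊆ U, x ∈ V ∧ s.IsOpen V) : s.IsOpen U :=
  s.isOpen_of_regular <| s.regular_of_locally (f := fun _ => 0) fun x hx =>
    let ⟨V, hVU, hxV, hV⟩ := h x hx
    ⟨V, hVU, hxV, s.regular_const 0 hV⟩

theorem isOpen_iInter {J : Type*} [Finite J] {U : J → Set X} (h : ∀ j, s.IsOpen (U j)) :
    s.IsOpen (⋂ j, U j) :=
  letI := s.toTopologicalSpace
  isOpen_iInter_of_finite h

/-- The structure that ignores everything outside an open set `U`. A morphism out of it is a map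
whose restriction to `U` is a morphism. -/
def restrict (s : FunctionStructure X) (U : Set X) (hU : s.IsOpen U) : FunctionStructure X where
  IsOpen V := s.IsOpen (U ∩ V)
  isOpen_univ := by rwa [Set.inter_univ]
  isOpen_inter V W hV hW := by
    rw [Set.inter_inter_distrib_left]; exact s.isOpen_inter _ _ hV hW
  isOpen_sUnion S hS := isOpen_of_locally fun x ⟨hx, V, hVS, hxV⟩ =>
    ⟨U ∩ V, fun _ hy => ⟨hy.1, V, hVS, hy.2⟩, ⟨hx, hxV⟩, hS V hVS⟩
  Regular V f := s.Regular (U ∩ V) f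
  isOpen_of_regular h := s.isOpen_of_regular h
  regular_congr h hfg := s.regular_congr h fun _ hx => hfg hx.2
  regular_mono h hV hVU := s.regular_mono h hV fun _ hx => ⟨hx.1, hVU hx.2⟩
  regular_of_locally h := s.regular_of_locally fun x hx =>
    let ⟨V, hVU, hxV, hV⟩ := h x hx.2
    ⟨U ∩ V, fun _ hy => ⟨hy.1, hVU hy.2⟩, ⟨hx.1, hxV⟩, hV⟩
  regular_const c hU := s.regular_const c hU
  regular_add := s.regular_add
  regular_mul := s.regular_mul
  isOpen_ne_zero {V f} h := by
    have := s.isOpen_ne_zero h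
    rwa [show {x ∈ U ∩ V | f x ≠ 0} = U ∩ {x ∈ V | f x ≠ 0} from Set.ext fun _ => and_assoc] at this
  regular_inv {V f} h := by
    have := s.regular_inv h
    rwa [show {x ∈ U ∩ V | f x ≠ 0} = U ∩ {x ∈ V | f x ≠ 0} from Set.ext fun _ => and_assoc] at this

theorem isMorphism_of_locally {φ : X → Y}
    (h : ∀ x, ∃ (U : Set X) (hU : s.IsOpen U) (ψ : X → Y), x ∈ U ∧ Set.EqOn φ ψ U ∧
      (s.restrict U hU).IsMorphism t ψ) : s.IsMorphism t φ := by
  refine ⟨fun V hV => isOpen_of_locally fun x hx => ?_,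
    fun V f hf => s.regular_of_locally fun x hx => ?_⟩
  · obtain ⟨U, hU, ψ, hxU, he, hψ⟩ := h x
    refine ⟨U ∩ ψ ⁻¹' V, fun y hy => ?_, ⟨hxU, ?_⟩, hψ.1 V hV⟩
    · have := hy.2; rwa [Set.mem_preimage, ← he hy.1] at this
    · rwa [Set.mem_preimage, ← he hxU]
  · obtain ⟨U, hU, ψ, hxU, he, hψ⟩ := h x
    refine ⟨U ∩ ψ ⁻¹' V, fun y hy => ?_, ⟨hxU, ?_⟩, s.regular_congr (hψ.2 V f hf) fun y hy => ?_⟩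
    · have := hy.2; rwa [Set.mem_preimage, ← he hy.1] at this
    · rwa [Set.mem_preimage, ← he hxU]
    · simp [he hy.1]

/-! ### Regular functions with values in vector spaces -/

theorem regular_sum {ι : Type*} (I : Finset ι) {U : Set X} (hU : s.IsOpen U) {f : ι → X → ℂ}
    (h : ∀ i ∈ I, s.Regular U (f i)) : s.Regular U fun x => ∑ i ∈ I, f i x := by
  classical
  induction I using Finset.induction_on with
  | empty => simpa using s.regular_const 0 hU
  | insert i I hi ih =>
    simp only [Finset.sum_insert hi]
    exact s.regular_add (h _ (Finset.mem_insert_self _ _))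
      (ih fun j hj => h j (Finset.mem_insert_of_mem hj))

theorem regular_prod {ι : Type*} (I : Finset ι) {U : Set X} (hU : s.IsOpen U) {f : ι → X → ℂ}
    (h : ∀ i ∈ I, s.Regular U (f i)) : s.Regular U fun x => ∏ i ∈ I, f i x := by
  classical
  induction I using Finset.induction_on with
  | empty => simpa using s.regular_const 1 hU
  | insert i I hi ih =>
    simp only [Finset.prod_insert hi]
    exact s.regular_mul (h _ (Finset.mem_insert_self _ _))
      (ih fun j hj => h j (Finset.mem_insert_of_mem hj))

theorem regular_det {ι : Type*} [Fintype ι] [DecidableEq ι] {U : Set X} (hU : s.IsOpen U)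
    {A : X → Matrix ι ι ℂ} (h : ∀ i j, s.Regular U fun x => A x i j) :
    s.Regular U fun x => (A x).det := by
  simp only [Matrix.det_apply']
  exact regular_sum _ hU fun σ _ => s.regular_mul (s.regular_const _ hU)
    (regular_prod _ hU fun i _ => h _ _)

theorem regular_matrix_inv {ι : Type*} [Fintype ι] [DecidableEq ι] {U : Set X} (hU : s.IsOpen U)
    {A : X → Matrix ι ι ℂ} (h : ∀ i j, s.Regular U fun x => A x i j) (i j : ι) :
    s.Regular {x ∈ U | (A x).det ≠ 0} fun x => (A x)⁻¹ i j := by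
  have hd := regular_det hU h
  have ha : s.Regular U fun x => (A x).adjugate i j := by
    simp only [Matrix.adjugate_apply]
    refine regular_det hU fun k l => ?_
    by_cases hk : k = j
    · subst hk; simpa using s.regular_const _ hU
    · simpa [Matrix.updateRow_apply, hk] using h k l
  refine s.regular_congr (s.regular_mul (s.regular_inv hd)
    (s.regular_mono ha (s.isOpen_ne_zero hd) fun _ hx => hx.1)) fun x _ => ?_
  simp [Matrix.inv_def]

/-- A vector valued function is regular on the open set `U` if its composites with all linear
functionals are. -/
def RegularVec (s : FunctionStructure X) {V : Type*} [AddCommGroup V] [Module ℂ V] (U : Set X)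
    (F : X → V) : Prop :=
  s.IsOpen U ∧ ∀ l : Module.Dual ℂ V, s.Regular U fun x => l (F x)

namespace RegularVec

variable {V W : Type*} [AddCommGroup V] [Module ℂ V] [AddCommGroup W] [Module ℂ W]
  {U U' : Set X} {F G : X → V}

theorem const (hU : s.IsOpen U) (a : V) : s.RegularVec U fun _ => a :=
  ⟨hU, fun l => s.regular_const (l a) hU⟩

theorem mono (hF : s.RegularVec U F) (hU' : s.IsOpen U') (h : U' ⊆ U) : s.RegularVec U' F :=
  ⟨hU', fun l => s.regular_mono (hF.2 l) hU' h⟩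

theorem add (hF : s.RegularVec U F) (hG : s.RegularVec U G) :
    s.RegularVec U fun x => F x + G x :=
  ⟨hF.1, fun l => by simpa using s.regular_add (hF.2 l) (hG.2 l)⟩

theorem smul {c : X → ℂ} (hc : s.Regular U c) (hF : s.RegularVec U F) :
    s.RegularVec U fun x => c x • F x :=
  ⟨hF.1, fun l => by simpa using s.regular_mul hc (hF.2 l)⟩

theorem sum {ι : Type*} (I : Finset ι) (hU : s.IsOpen U) {F : ι → X → V}
    (h : ∀ i ∈ I, s.RegularVec U (F i)) : s.RegularVec U fun x => ∑ i ∈ I, F i x :=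
  ⟨hU, fun l => by simpa using regular_sum I hU fun i hi => (h i hi).2 l⟩

theorem linearMap (f : V →ₗ[ℂ] W) (hF : s.RegularVec U F) : s.RegularVec U fun x => f (F x) :=
  ⟨hF.1, fun l => hF.2 (l ∘ₗ f)⟩

theorem comp {F : Y → V} {U : Set Y} (hF : t.RegularVec U F) {φ : X → Y} (hφ : s.IsMorphism t φ) :
    s.RegularVec (φ ⁻¹' U) fun x => F (φ x) :=
  ⟨hφ.1 _ hF.1, fun l => hφ.2 _ _ (hF.2 l)⟩

/-- Applying a regular family of linear maps to a regular family of vectors gives a regular family,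
as one sees by expanding the vectors in a basis. -/
theorem apply [FiniteDimensional ℂ V] {g : X → V →ₗ[ℂ] W} (hg : ∀ a, s.RegularVec U fun x => g x a)
    (hF : s.RegularVec U F) : s.RegularVec U fun x => g x (F x) := by
  let b := Module.finBasis ℂ V
  have : (fun x => g x (F x)) = fun x => ∑ i, b.coord i (F x) • g x (b i) := by
    funext x
    conv_lhs => rw [← b.sum_repr (F x)]
    simp only [map_sum, map_smul, Module.Basis.coord_apply]
  rw [this]
  exact sum _ hF.1 fun i _ => smul (hF.2 _) (hg _)

/-- A regular family of endomorphisms that is invertible at a point is invertible near this point,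
and the inverses form a regular family. -/
theorem exists_inverse [FiniteDimensional ℂ V] {g : X → V →ₗ[ℂ] V} (hU : s.IsOpen U)
    (hg : ∀ a, s.RegularVec U fun x => g x a) {x₀ : X} (hx₀ : x₀ ∈ U) (h₀ : g x₀ = LinearMap.id) :
    ∃ U' ⊆ U, x₀ ∈ U' ∧ s.IsOpen U' ∧ ∃ g' : X → V →ₗ[ℂ] V,
      (∀ a, s.RegularVec U' fun x => g' x a) ∧
      ∀ x ∈ U', g' x ∘ₗ g x = LinearMap.id ∧ g x ∘ₗ g' x = LinearMap.id := by
  let b := Module.finBasis ℂ V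
  let A : X → Matrix _ _ ℂ := fun x => LinearMap.toMatrix b b (g x)
  have hA : ∀ i j, s.Regular U fun x => A x i j := fun i j => by
    simpa [A, LinearMap.toMatrix_apply] using (hg (b j)).2 (b.coord i)
  have hU' := s.isOpen_ne_zero (regular_det hU hA)
  refine ⟨{x ∈ U | (A x).det ≠ 0}, fun _ h => h.1, ⟨hx₀, ?_⟩, hU',
    fun x => Matrix.toLin b b (A x)⁻¹, fun a => ?_, fun x hx => ?_⟩
  · simp [A, h₀]
  · simp only [Matrix.toLin_apply]
    refine sum _ hU' fun i _ => smul ?_ (const hU' _)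
    simp only [Matrix.mulVec, dotProduct]
    exact regular_sum _ hU' fun j _ => s.regular_mul (regular_matrix_inv hU hA i j)
      (s.regular_const _ hU')
  · have hg : g x = Matrix.toLin b b (A x) := (Matrix.toLin_toMatrix b b (g x)).symm
    have hu : IsUnit (A x).det := isUnit_iff_ne_zero.2 hx.2
    constructor
    · rw [hg, ← Matrix.toLin_mul, Matrix.nonsing_inv_mul _ hu, Matrix.toLin_one]
    · rw [hg, ← Matrix.toLin_mul, Matrix.mul_nonsing_inv _ hu, Matrix.toLin_one]

/-- Linear independence of regular families is an open condition. -/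
theorem exists_linearIndependent {ι : Type*} [Finite ι] (hU : s.IsOpen U)
    {F : ι → X → V} (hF : ∀ i, s.RegularVec U (F i)) {x₀ : X} (hx₀ : x₀ ∈ U)
    (h₀ : LinearIndependent ℂ fun i => F i x₀) :
    ∃ U' ⊆ U, x₀ ∈ U' ∧ s.IsOpen U' ∧ ∀ x ∈ U', LinearIndependent ℂ fun i => F i x := by
  classical
  have := Fintype.ofFinite ι
  -- Functionals that are dual to the given vectors at `x₀` detect independence by a determinant.
  obtain ⟨l, hl⟩ := LinearMap.exists_extend (p := Submodule.span ℂ (Set.range fun i => F i x₀))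
    (Module.Basis.span h₀).equivFun.toLinearMap
  have hl₀ : ∀ i, l (F i x₀) = Pi.single i 1 := fun i => by
    have h1 := LinearMap.congr_fun hl (Module.Basis.span h₀ i)
    have h2 : (Module.Basis.span h₀ i : V) = F i x₀ := by rw [Module.Basis.span_apply]
    simp only [LinearMap.comp_apply, Submodule.subtype_apply, h2] at h1
    rw [h1]
    ext j
    simp [Finsupp.single_apply, Pi.single_apply, eq_comm]
  let A : X → Matrix ι ι ℂ := fun x i j => l (F i x) j
  have hA : ∀ i j, s.Regular U fun x => A x i j := fun i j => (hF i).2 (LinearMap.proj j ∘ₗ l)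
  refine ⟨{x ∈ U | (A x).det ≠ 0}, fun _ h => h.1, ⟨hx₀, ?_⟩, s.isOpen_ne_zero (regular_det hU hA),
    fun x hx => ?_⟩
  · have : A x₀ = 1 := by
      ext i j
      simp [A, hl₀, Matrix.one_apply, Pi.single_apply, eq_comm]
    simp [this]
  · have : LinearIndependent ℂ (A x).row :=
      Matrix.linearIndependent_rows_iff_isUnit.2
        ((Matrix.isUnit_iff_isUnit_det _).2 (isUnit_iff_ne_zero.2 hx.2))
    exact LinearIndependent.of_comp l this

end RegularVec

/-! ### Morphisms to affine spaces -/

section affine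

variable {V : Type v} [AddCommGroup V] [Module ℂ V]

theorem affine_regular_dual (l : Module.Dual ℂ V) : (affine V).Regular Set.univ l :=
  ⟨(affine V).isOpen_univ, fun _ _ => ⟨l, Algebra.subset_adjoin ⟨l, rfl⟩, 1, one_mem _, by simp,
    fun _ _ _ => by simp⟩⟩

theorem isMorphism_affine {F : X → V} (hF : s.RegularVec Set.univ F) :
    s.IsMorphism (affine V) F := by
  have hp : ∀ p ∈ polynomialFunctions V, s.Regular Set.univ (p ∘ F) := by
    intro p hp
    induction hp using Algebra.adjoin_induction with
    | mem p hp => obtain ⟨l, rfl⟩ := hp; exact hF.2 l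
    | algebraMap c => exact s.regular_const c s.isOpen_univ
    | add p q _ _ hp hq => exact s.regular_add hp hq
    | mul p q _ _ hp hq => exact s.regular_mul hp hq
  have hU : ∀ U, (affine V).IsOpen U → s.IsOpen (F ⁻¹' U) := fun U hU =>
    isOpen_of_locally fun x hx => by
      obtain ⟨q, hq, hqx, hqU⟩ := hU _ hx
      exact ⟨{y ∈ Set.univ | (q ∘ F) y ≠ 0}, fun y hy => hqU _ hy.2, ⟨Set.mem_univ x, hqx⟩,
        s.isOpen_ne_zero (hp q hq)⟩
  refine ⟨hU, fun U f hf => s.regular_of_locally fun x hx => ?_⟩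
  obtain ⟨p, hp', q, hq, hqx, hpq⟩ := hf.2 _ hx
  have ho := s.isOpen_inter _ _ (hU U hf.1) (s.isOpen_ne_zero (hp q hq))
  refine ⟨F ⁻¹' U ∩ {y ∈ Set.univ | (q ∘ F) y ≠ 0}, Set.inter_subset_left,
    ⟨hx, Set.mem_univ _, hqx⟩,
    s.regular_congr (s.regular_mul (s.regular_mono (hp p hp') ho (Set.subset_univ _))
      (s.regular_mono (s.regular_inv (hp q hq)) ho Set.inter_subset_right)) fun y hy => ?_⟩
  exact (hpq _ hy.1 hy.2.2).symm

end affine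

end FunctionStructure

/-! ### Subspaces and products -/

namespace SpaceWithFunctions

open FunctionStructure

section sub

variable {X : SpaceWithFunctions.{u}} {Z : Type v} {s : FunctionStructure Z} {S : Set X}

theorem isMorphism_val : (X.sub S).str.IsMorphism X.str (fun x => x.1) :=
  coarsest_isMorphism fun _ h => h

theorem isMorphism_sub {φ : Z → X.sub S} (h : s.IsMorphism X.str fun z => (φ z).1) :
    s.IsMorphism (X.sub S).str φ :=
  isMorphism_coarsest h

end sub

section prod

variable {X : SpaceWithFunctions.{u}} {Y : SpaceWithFunctions.{v}} {Z : Type w}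
  {s : FunctionStructure Z}

theorem isMorphism_fst : (X.prod Y).str.IsMorphism X.str (fun x => x.1) :=
  coarsest_isMorphism fun _ h => h.1

theorem isMorphism_snd : (X.prod Y).str.IsMorphism Y.str (fun x => x.2) :=
  coarsest_isMorphism fun _ h => h.2

theorem isMorphism_prod {φ : Z → X.prod Y} (h₁ : s.IsMorphism X.str fun z => (φ z).1)
    (h₂ : s.IsMorphism Y.str fun z => (φ z).2) : s.IsMorphism (X.prod Y).str φ :=
  isMorphism_coarsest ⟨h₁, h₂⟩

end prod

section pi

variable {J : Type w} {X : J → SpaceWithFunctions.{u}} {Z : Type v} {s : FunctionStructure Z}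

theorem isMorphism_eval (j : J) : (pi X).str.IsMorphism (X j).str (fun x => x j) :=
  coarsest_isMorphism fun _ h => h j

theorem isMorphism_pi {φ : Z → pi X} (h : ∀ j, s.IsMorphism (X j).str fun z => φ z j) :
    s.IsMorphism (pi X).str φ :=
  isMorphism_coarsest h

end pi

namespace Iso

/-- The inverse isomorphism. -/
def symm {X : SpaceWithFunctions.{u}} {Y : SpaceWithFunctions.{v}} (e : Iso X Y) : Iso Y X where
  toEquiv := e.toEquiv.symm
  isMorphism_toFun := e.isMorphism_invFun
  isMorphism_invFun := e.isMorphism_toFun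

/-- The composition of isomorphisms. -/
def trans {X : SpaceWithFunctions.{u}} {Y : SpaceWithFunctions.{v}} {Z : SpaceWithFunctions.{w}}
    (e : Iso X Y) (f : Iso Y Z) : Iso X Z where
  toEquiv := e.toEquiv.trans f.toEquiv
  isMorphism_toFun := f.isMorphism_toFun.comp e.isMorphism_toFun
  isMorphism_invFun := e.isMorphism_invFun.comp f.isMorphism_invFun

/-- An isomorphism restricts to an isomorphism between corresponding subsets. -/
def sub {X : SpaceWithFunctions.{u}} {Y : SpaceWithFunctions.{v}} (e : Iso X Y) {S : Set X}
    {T : Set Y} (h : ∀ x, x ∈ S ↔ e.toEquiv x ∈ T) : Iso (X.sub S) (Y.sub T) where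
  toEquiv := e.toEquiv.subtypeEquiv h
  isMorphism_toFun := isMorphism_sub (e.isMorphism_toFun.comp isMorphism_val)
  isMorphism_invFun := isMorphism_sub (e.isMorphism_invFun.comp isMorphism_val)

/-- A subset containing all points is isomorphic to the whole space. -/
def subUniv (X : SpaceWithFunctions.{u}) {S : Set X} (h : ∀ x, x ∈ S) : Iso (X.sub S) X where
  toEquiv := Equiv.subtypeUnivEquiv h
  isMorphism_toFun := isMorphism_val
  isMorphism_invFun := isMorphism_sub IsMorphism.id

/-- Products of isomorphic families, along a bijection of the index sets. -/
def piCongr {J : Type*} {J' : Type*} {X : J → SpaceWithFunctions.{u}}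
    {Y : J' → SpaceWithFunctions.{v}} (σ : J ≃ J') (e : ∀ j, Iso (X j) (Y (σ j))) :
    Iso (pi X) (pi Y) where
  toEquiv := Equiv.piCongr (W := fun j => X j) (Z := fun j => Y j) σ fun j => (e j).toEquiv
  isMorphism_toFun := isMorphism_pi fun j' => by
    obtain ⟨j, rfl⟩ := σ.surjective j'
    have h : (fun x : pi X => (Equiv.piCongr (W := fun j => X j) (Z := fun j => Y j) σ
        fun j => (e j).toEquiv) x (σ j)) = (e j).toFun ∘ fun x => x j :=
      funext fun x => Equiv.piCongr_apply_apply (W := fun j => X j) (Z := fun j => Y j) σ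
        (fun j => (e j).toEquiv) x j
    have := (e j).isMorphism_toFun.comp (isMorphism_eval (X := X) j)
    rwa [← h] at this
  isMorphism_invFun := isMorphism_pi fun j =>
    (e j).isMorphism_invFun.comp (isMorphism_eval (σ j))

end Iso

/-! ### Morphisms to and from Grassmannians -/

section grassmannian

variable {Z : Type w} {s : FunctionStructure Z} {V : Type u} [AddCommGroup V] [Module ℂ V] {e : ℕ}

theorem regularVec_frame (j : Fin e) :
    (frames V e).str.RegularVec Set.univ fun F => F.1 j :=
  ⟨(frames V e).str.isOpen_univ, fun l =>
    (isMorphism_val (X := ⟨Fin e → V, affine (Fin e → V)⟩)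
      (S := {F | LinearIndependent ℂ F})).2 Set.univ _
      (affine_regular_dual (l ∘ₗ LinearMap.proj (φ := fun _ : Fin e => V) j))⟩

theorem isMorphism_frames {φ : Z → frames V e}
    (h : ∀ j, s.RegularVec Set.univ fun z => (φ z).1 j) : s.IsMorphism (frames V e).str φ := by
  refine isMorphism_sub (isMorphism_affine ⟨s.isOpen_univ, fun l => ?_⟩)
  have hl : ∀ F : Fin e → V, l F = ∑ j, (l ∘ₗ LinearMap.single ℂ (fun _ => V) j) (F j) := fun F => by
    conv_lhs => rw [← Finset.univ_sum_single F]
    simp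
  simp only [hl]
  exact regular_sum _ s.isOpen_univ fun j _ => (h j).2 _

/-- The span of a frame. -/
def frameSpan (F : frames V e) : grassmannian V e :=
  ⟨Submodule.span ℂ (Set.range F.1), by rw [finrank_span_eq_card F.2, Fintype.card_fin]⟩

theorem isMorphism_frameSpan :
    (frames V e).str.IsMorphism (grassmannian V e).str (frameSpan (V := V) (e := e)) :=
  ⟨fun _ h => h, fun _ _ h => h⟩

/-- A map to a Grassmannian is a morphism if its values are locally spanned by finitely many
regular vector valued functions. -/
theorem isMorphism_grassmannian [FiniteDimensional ℂ V] {φ : Z → grassmannian V e}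
    (h : ∀ z, ∃ (U : Set Z) (ι : Type) (F : ι → Z → V), s.IsOpen U ∧ z ∈ U ∧
      (∀ i, s.RegularVec U (F i)) ∧
        ∀ z ∈ U, Submodule.span ℂ (Set.range fun i => F i z) = (φ z).1) :
    s.IsMorphism (grassmannian V e).str φ := by
  classical
  refine isMorphism_of_locally fun z₀ => ?_
  obtain ⟨U, ι, F, hU, hz₀, hF, hφ⟩ := h z₀
  -- Select a basis at `z₀` among the given vectors; it remains a basis near `z₀`.
  obtain ⟨a, ha⟩ : ∃ a : Fin e → ι, LinearIndependent ℂ fun j => F (a j) z₀ := by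
    obtain ⟨f, hfm, -, hfi⟩ :=
      Submodule.exists_fun_fin_finrank_span_eq ℂ (Set.range fun i => F i z₀)
    choose a ha using hfm
    have he : e = Module.finrank ℂ (Submodule.span ℂ (Set.range fun i => F i z₀)) := by
      rw [hφ z₀ hz₀, (φ z₀).2]
    refine ⟨fun j => a (Fin.cast he j), ?_⟩
    simp only [ha]
    exact hfi.comp _ (Fin.cast_injective he)
  obtain ⟨U', hU'U, hz₀', hU', hind⟩ :=
    RegularVec.exists_linearIndependent hU (fun j => hF (a j)) hz₀ ha
  let ψ : Z → frames V e := fun z =>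
    if hz : LinearIndependent ℂ fun j => F (a j) z then ⟨_, hz⟩ else ⟨_, ha⟩
  have hψ : ∀ z ∈ U', (ψ z).1 = fun j => F (a j) z := fun z hz =>
    congrArg Subtype.val (dif_pos (hind z hz))
  refine ⟨U', hU', frameSpan ∘ ψ, hz₀', fun z hz => Subtype.ext ?_,
    isMorphism_frameSpan.comp (isMorphism_frames fun j => ⟨(s.restrict U' hU').isOpen_univ,
      fun l => ?_⟩)⟩
  · symm
    refine Submodule.eq_of_le_of_finrank_eq ?_ ?_
    · change Submodule.span ℂ (Set.range (ψ z).1) ≤ _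
      rw [hψ z hz, ← hφ z (hU'U hz), Submodule.span_le]
      rintro _ ⟨j, rfl⟩
      exact Submodule.subset_span ⟨a j, rfl⟩
    · exact (frameSpan (ψ z)).2.trans (φ z).2.symm
  · refine s.regular_congr (s.regular_mono ((hF (a j)).2 l) (U := U) (V := U' ∩ Set.univ) ?_ ?_) ?_
    · simpa using hU'
    · exact fun z hz => hU'U hz.1
    · intro z hz
      simp [hψ z hz.1]

/-- Near every point, the universal subspace on a Grassmannian has a regular frame: the one that is
dual to a fixed tuple of functionals. -/
theorem exists_regularVec_section [FiniteDimensional ℂ V] (p₀ : grassmannian V e) :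
    ∃ (U : Set (grassmannian V e)) (F : Fin e → grassmannian V e → V),
      (grassmannian V e).str.IsOpen U ∧ p₀ ∈ U ∧
      (∀ i, (grassmannian V e).str.RegularVec U (F i)) ∧
        ∀ p ∈ U, LinearIndependent ℂ (fun i => F i p) ∧
          Submodule.span ℂ (Set.range fun i => F i p) = p.1 := by
  classical
  let b := Module.finBasisOfFinrankEq ℂ p₀.1 p₀.2
  obtain ⟨l, hl⟩ := LinearMap.exists_extend b.equivFun.toLinearMap
  have hl₀ : ∀ v (hv : v ∈ p₀.1), l v = b.equivFun ⟨v, hv⟩ := fun v hv =>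
    LinearMap.congr_fun hl ⟨v, hv⟩
  let U : Set (grassmannian V e) := {p | ∀ v ∈ p.1, l v = 0 → v = 0}
  -- On `U`, the map `l` restricts to an isomorphism from the subspace to `ℂ ^ e`.
  have hex : ∀ p ∈ U, ∀ j, ∃ v ∈ p.1, l v = Pi.single j 1 := fun p hp j => by
    let f : p.1 →ₗ[ℂ] (Fin e → ℂ) := l ∘ₗ p.1.subtype
    have hf : Function.Injective f := (injective_iff_map_eq_zero f).2 fun v hv =>
      Subtype.ext (hp v.1 v.2 hv)
    obtain ⟨v, hv⟩ := (LinearMap.injective_iff_surjective_of_finrank_eq_finrank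
      (by rw [p.2, Module.finrank_fin_fun])).1 hf (Pi.single j 1)
    exact ⟨v.1, v.2, hv⟩
  let F : Fin e → grassmannian V e → V := fun j p =>
    if h : ∃ v ∈ p.1, l v = Pi.single j 1 then h.choose else 0
  have hFm : ∀ p ∈ U, ∀ j, F j p ∈ p.1 := fun p hp j => by
    simp only [F, dif_pos (hex p hp j)]; exact (hex p hp j).choose_spec.1
  have hFl : ∀ p ∈ U, ∀ j, l (F j p) = Pi.single j 1 := fun p hp j => by
    simp only [F, dif_pos (hex p hp j)]; exact (hex p hp j).choose_spec.2
  have hFu : ∀ p ∈ U, ∀ j, ∀ v ∈ p.1, l v = Pi.single j 1 → v = F j p := fun p hp j v hv hlv =>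
    sub_eq_zero.1 (hp _ (sub_mem hv (hFm p hp j)) (by rw [map_sub, hlv, hFl p hp j, sub_self]))
  let A : frames V e → Matrix (Fin e) (Fin e) ℂ := fun G => Matrix.of fun i j => l (G.1 j) i
  have hA : ∀ i j, (frames V e).str.Regular Set.univ fun G => A G i j := fun i j =>
    (regularVec_frame j).2 (LinearMap.proj i ∘ₗ l)
  have hAl : ∀ G c, l (∑ j, c j • G.1 j) = (A G).mulVec c := fun G c => by
    ext i
    simp [A, Matrix.mulVec, dotProduct, mul_comm]
  have hUA : ∀ G : frames V e, frameSpan G ∈ U ↔ (A G).det ≠ 0 := fun G => by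
    constructor
    · intro h hd
      obtain ⟨c, hc0, hc⟩ := Matrix.exists_mulVec_eq_zero_iff.2 hd
      rw [← hAl] at hc
      have := h _ (sum_mem fun j _ => Submodule.smul_mem _ _ (Submodule.subset_span ⟨j, rfl⟩)) hc
      exact hc0 (funext (Fintype.linearIndependent_iff.1 G.2 c this))
    · intro hd v hv hv0
      obtain ⟨c, rfl⟩ := (Submodule.mem_span_range_iff_exists_fun ℂ).1 hv
      rw [hAl] at hv0
      have : c = 0 := by
        by_contra hc
        exact hd (Matrix.exists_mulVec_eq_zero_iff.1 ⟨c, hc, hv0⟩)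
      simp [this]
  have hpre : frameSpan ⁻¹' U = {G ∈ Set.univ | (A G).det ≠ 0} := by
    ext G; simp [hUA]
  have hUo : (grassmannian V e).str.IsOpen U := by
    change (frames V e).str.IsOpen (frameSpan ⁻¹' U)
    rw [hpre]
    exact (frames V e).str.isOpen_ne_zero (regular_det (frames V e).str.isOpen_univ hA)
  refine ⟨U, F, hUo, fun v hv h0 => ?_, fun j => ⟨hUo, fun m => ?_⟩, fun p hp => ?_⟩
  · rw [hl₀ v hv] at h0
    simpa using h0
  · change (frames V e).str.Regular (frameSpan ⁻¹' U) _
    rw [hpre]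
    -- In terms of a frame `G`, the dual frame is `G * A(G)⁻¹`.
    refine (frames V e).str.regular_congr
      (f := fun G => ∑ k, (A G)⁻¹ k j * m (G.1 k)) (regular_sum _ ?_ fun k _ =>
      (frames V e).str.regular_mul (regular_matrix_inv (frames V e).str.isOpen_univ hA k j)
        ((frames V e).str.regular_mono ((regularVec_frame k).2 m) ?_ (Set.subset_univ _))) ?_
    · exact (frames V e).str.isOpen_ne_zero (regular_det (frames V e).str.isOpen_univ hA)
    · exact (frames V e).str.isOpen_ne_zero (regular_det (frames V e).str.isOpen_univ hA)
    · intro G hG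
      have := hFu (frameSpan G) ((hUA G).2 hG.2) j (∑ k, (A G)⁻¹ k j • G.1 k)
        (sum_mem fun k _ => Submodule.smul_mem _ _ (Submodule.subset_span ⟨k, rfl⟩)) ?_
      · change _ = m (F j (frameSpan G))
        rw [← this]; simp
      · rw [hAl]
        have hi := Matrix.mul_nonsing_inv (A G) (isUnit_iff_ne_zero.2 hG.2)
        ext i
        have := congrFun (congrFun hi i) j
        rw [Matrix.mul_apply] at this
        simp [Matrix.mulVec, dotProduct, this, Matrix.one_apply, Pi.single_apply]
  · have hind : LinearIndependent ℂ fun j => F j p := by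
      refine LinearIndependent.of_comp l ?_
      have : (l ∘ fun j => F j p) = Pi.basisFun ℂ (Fin e) := by
        funext j; simp [hFl p hp j]
      rw [this]
      exact (Pi.basisFun ℂ (Fin e)).linearIndependent
    refine ⟨hind, Submodule.eq_of_le_of_finrank_eq ?_ ?_⟩
    · rw [Submodule.span_le]
      rintro _ ⟨j, rfl⟩
      exact hFm p hp j
    · rw [finrank_span_eq_card hind, Fintype.card_fin, p.2]

/-- A morphism to a Grassmannian is locally spanned by a regular family of frames. -/
theorem exists_regularVec_frame [FiniteDimensional ℂ V] {φ : Z → grassmannian V e}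
    (hφ : s.IsMorphism (grassmannian V e).str φ) (z₀ : Z) :
    ∃ (U : Set Z) (F : Fin e → Z → V), s.IsOpen U ∧ z₀ ∈ U ∧ (∀ i, s.RegularVec U (F i)) ∧
      ∀ z ∈ U, LinearIndependent ℂ (fun i => F i z) ∧
        Submodule.span ℂ (Set.range fun i => F i z) = (φ z).1 := by
  obtain ⟨U, F, hUo, hU, hF, h⟩ := exists_regularVec_section (φ z₀)
  exact ⟨φ ⁻¹' U, fun j z => F j (φ z), hφ.1 _ hUo, hU, fun j => (hF j).comp hφ,
    fun z hz => h _ hz⟩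

end grassmannian

/-! ### Images, preimages and containment of subspaces -/

section linear

variable {Z : Type w} {s : FunctionStructure Z} {V : Type u} [AddCommGroup V] [Module ℂ V]
  [FiniteDimensional ℂ V] {V' : Type v} [AddCommGroup V'] [Module ℂ V'] [FiniteDimensional ℂ V']
  {e e' : ℕ}

/-- Taking images of subspaces under a linear map is a morphism, as long as the dimensions of the
images are constant. -/
theorem isMorphism_map (f : V →ₗ[ℂ] V') {φ : Z → grassmannian V e} {ψ : Z → grassmannian V' e'}
    (hφ : s.IsMorphism (grassmannian V e).str φ) (h : ∀ z, (ψ z).1 = (φ z).1.map f) :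
    s.IsMorphism (grassmannian V' e').str ψ :=
  isMorphism_grassmannian fun z₀ => by
    obtain ⟨U, F, hU, hz₀, hF, hφ⟩ := exists_regularVec_frame hφ z₀
    refine ⟨U, Fin e, fun j z => f (F j z), hU, hz₀, fun j => (hF j).linearMap f, fun z hz => ?_⟩
    rw [h, ← (hφ z hz).2, Submodule.map_span, ← Set.range_comp]
    rfl

/-- Taking preimages of subspaces under a surjective linear map is a morphism. -/
theorem isMorphism_comap (f : V' →ₗ[ℂ] V) (hf : Function.Surjective f) {φ : Z → grassmannian V e}
    {ψ : Z → grassmannian V' e'} (hφ : s.IsMorphism (grassmannian V e).str φ)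
    (h : ∀ z, (ψ z).1 = (φ z).1.comap f) : s.IsMorphism (grassmannian V' e').str ψ :=
  isMorphism_grassmannian fun z₀ => by
    obtain ⟨U, F, hU, hz₀, hF, hφ⟩ := exists_regularVec_frame hφ z₀
    obtain ⟨g, hg⟩ := f.exists_rightInverse_of_surjective (LinearMap.range_eq_top.2 hf)
    have hg : ∀ x, f (g x) = x := LinearMap.congr_fun hg
    obtain ⟨m, b, hb⟩ := Submodule.fg_iff_exists_fin_generating_family.1
      (IsNoetherian.noetherian (LinearMap.ker f))
    refine ⟨U, Fin e ⊕ Fin m, fun j z => Sum.elim (fun j => g (F j z)) b j, hU,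
      hz₀, Sum.rec (fun j => (hF j).linearMap g) fun j => RegularVec.const hU _, fun z hz => ?_⟩
    have hg' : Submodule.span ℂ (Set.range fun j => g (F j z)) = (φ z).1.map g := by
      rw [← (hφ z hz).2, Submodule.map_span, ← Set.range_comp]; rfl
    change Submodule.span ℂ (Set.range (Sum.elim (fun j => g (F j z)) b)) = _
    rw [Set.Sum.elim_range, Submodule.span_union, hb, hg', h]
    refine le_antisymm (sup_le ?_ fun x hx => ?_) fun x hx => ?_
    · rintro _ ⟨x, hx, rfl⟩
      rwa [Submodule.mem_comap, hg]
    · rw [Submodule.mem_comap, LinearMap.mem_ker.1 hx]; exact zero_mem _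
    · refine Submodule.mem_sup.2 ⟨g (f x), ⟨_, hx, rfl⟩, x - g (f x), ?_, by abel⟩
      simp [hg]

/-- Linear isomorphisms induce isomorphisms of Grassmannians. -/
noncomputable def Iso.grassmannianCongr (f : V ≃ₗ[ℂ] V') (h : e = e') :
    Iso (grassmannian V e) (grassmannian V' e') where
  toFun U := ⟨U.1.map f.toLinearMap, (f.finrank_map_eq U.1).trans (U.2.trans h)⟩
  invFun U := ⟨U.1.map f.symm.toLinearMap, (f.symm.finrank_map_eq U.1).trans (U.2.trans h.symm)⟩
  left_inv U := Subtype.ext <| by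
    change (U.1.map f.toLinearMap).map f.symm.toLinearMap = U.1
    rw [← Submodule.map_comp, LinearEquiv.symm_comp, Submodule.map_id]
  right_inv U := Subtype.ext <| by
    change (U.1.map f.symm.toLinearMap).map f.toLinearMap = U.1
    rw [← Submodule.map_comp, LinearEquiv.comp_symm, Submodule.map_id]
  isMorphism_toFun := isMorphism_map f.toLinearMap IsMorphism.id fun _ => rfl
  isMorphism_invFun := isMorphism_map f.symm.toLinearMap IsMorphism.id fun _ => rfl

/-- For varying subspaces `φ z` and `ψ z`, the condition `f (φ z) ⊆ ψ z` is closed. -/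
theorem isOpen_compl_map_le (f : V →ₗ[ℂ] V') {φ : Z → grassmannian V e} {ψ : Z → grassmannian V' e'}
    (hφ : s.IsMorphism (grassmannian V e).str φ) (hψ : s.IsMorphism (grassmannian V' e').str ψ) :
    s.IsOpen {z | ∀ x ∈ (φ z).1, f x ∈ (ψ z).1}ᶜ := by
  refine isOpen_of_locally fun z₀ hz₀ => ?_
  obtain ⟨U, F, hU, hzU, hF, hFφ⟩ := exists_regularVec_frame hφ z₀
  obtain ⟨U', G, hU', hzU', hG, hGψ⟩ := exists_regularVec_frame hψ z₀
  obtain ⟨j, hj⟩ : ∃ j, f (F j z₀) ∉ (ψ z₀).1 := by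
    by_contra! h
    refine hz₀ fun x hx => ?_
    have : (φ z₀).1 ≤ (ψ z₀).1.comap f := by
      rw [← (hFφ z₀ hzU).2, Submodule.span_le]
      rintro _ ⟨j, rfl⟩
      exact h j
    exact this hx
  have hUU := s.isOpen_inter _ _ hU hU'
  let H : Option (Fin e') → Z → V' := fun o z => o.elim (f (F j z)) fun i => G i z
  have hH : ∀ o, s.RegularVec (U ∩ U') (H o) := by
    rintro (_ | i)
    · exact ((hF j).linearMap f).mono hUU Set.inter_subset_left
    · exact (hG i).mono hUU Set.inter_subset_right
  have hHi : ∀ z, LinearIndependent ℂ (fun o => H o z) ↔ LinearIndependent ℂ (fun i => G i z) ∧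
      f (F j z) ∉ Submodule.span ℂ (Set.range fun i => G i z) := fun z => linearIndependent_option
  obtain ⟨W, hW, hzW, hWo, hWi⟩ := RegularVec.exists_linearIndependent hUU hH ⟨hzU, hzU'⟩
    ((hHi z₀).2 ⟨(hGψ z₀ hzU').1, by rwa [(hGψ z₀ hzU').2]⟩)
  refine ⟨W, fun z hz h => ?_, hzW, hWo⟩
  have := ((hHi z).1 (hWi z hz)).2
  rw [(hGψ z (hW hz).2).2] at this
  refine this (h _ ?_)
  rw [← (hFφ z (hW hz).1).2]
  exact Submodule.subset_span ⟨j, rfl⟩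

end linear

/-- Closed subsets of finite products of Grassmannians are projective varieties. -/
theorem isProjectiveVariety_sub_pi {J : Type w} [Finite J] (V : J → Type u)
    [∀ j, AddCommGroup (V j)] [∀ j, Module ℂ (V j)] [∀ j, FiniteDimensional ℂ (V j)] (e : J → ℕ)
    (S : Set (pi fun j => grassmannian (V j) (e j)))
    (hS : (pi fun j => grassmannian (V j) (e j)).str.IsOpen Sᶜ) :
    IsProjectiveVariety ((pi fun j => grassmannian (V j) (e j)).sub S) := by
  let σ := Finite.equivFin J
  let f : Iso (pi fun j => grassmannian (V j) (e j))
      (pi fun t => grassmannian (Fin (Module.finrank ℂ (V (σ.symm t))) → ℂ) (e (σ.symm t))) :=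
    (Iso.piCongr σ.symm fun t => Iso.grassmannianCongr
      (LinearEquiv.ofFinrankEq _ _ (by simp)) rfl).symm
  refine ⟨_, _, _, f.symm.toFun ⁻¹' S, f.isMorphism_invFun.1 _ hS, ⟨f.sub fun x => ?_⟩⟩
  change x ∈ S ↔ f.toEquiv.symm (f.toEquiv x) ∈ S
  rw [Equiv.symm_apply_apply]

/-! ### Grassmannian bundles -/

/-- Subspaces between `T` and `P` correspond to subspaces of `P / T`. Here `h` extends a surjection
from `P` to `ℂ ^ b` with kernel `T`, and `k` is a section of it with values in `P`. -/
theorem exists_quotient_section {A : Type u} [AddCommGroup A] [Module ℂ A] [FiniteDimensional ℂ A]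
    {T P : Submodule ℂ A} (hTP : T ≤ P) {t b : ℕ} (ht : Module.finrank ℂ T = t)
    (hb : Module.finrank ℂ P = t + b) :
    ∃ (h : A →ₗ[ℂ] (Fin b → ℂ)) (k : (Fin b → ℂ) →ₗ[ℂ] A),
      (∀ G : Submodule ℂ (Fin b → ℂ), T ⊔ G.map k ≤ P) ∧
      (∀ V, T ≤ V → V ≤ P → T ⊔ (V.map h).map k = V) ∧
      (∀ G : Submodule ℂ (Fin b → ℂ), (T ⊔ G.map k).map h = G) ∧
      ∀ G : Submodule ℂ (Fin b → ℂ), Module.finrank ℂ ↥(T ⊔ G.map k) = t + Module.finrank ℂ G := by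
  let T' : Submodule ℂ P := T.comap P.subtype
  have hT' : Module.finrank ℂ T' = t := by
    rw [← ht]; exact (Submodule.comapSubtypeEquivOfLe hTP).finrank_eq
  let q : (P ⧸ T') ≃ₗ[ℂ] (Fin b → ℂ) := LinearEquiv.ofFinrankEq _ _ (by
    have := T'.finrank_quotient_add_finrank
    rw [Module.finrank_fin_fun]; omega)
  obtain ⟨r, hr⟩ := P.subtype.exists_leftInverse_of_injective P.ker_subtype
  have hr : ∀ x : P, r x.1 = x := LinearMap.congr_fun hr
  let f : P →ₗ[ℂ] (Fin b → ℂ) := q.toLinearMap ∘ₗ T'.mkQ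
  have hfs : LinearMap.range f = ⊤ :=
    LinearMap.range_eq_top.2 (q.surjective.comp T'.mkQ_surjective)
  have hf : ∀ x, f x = 0 ↔ x.1 ∈ T := fun x => by
    simp [f, T']
  obtain ⟨g, hg⟩ := f.exists_rightInverse_of_surjective hfs
  let h := f ∘ₗ r
  let k := P.subtype ∘ₗ g
  have hhk : ∀ c, h (k c) = c := fun c => by simpa [h, k, hr] using LinearMap.congr_fun hg c
  have hkP : ∀ c, k c ∈ P := fun c => (g c).2
  have hh : ∀ x ∈ P, h x = 0 ↔ x ∈ T := fun x hx => by
    change f (r (⟨x, hx⟩ : P)) = 0 ↔ _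
    rw [hr, hf]
  have hhT : T.map h = ⊥ := by
    refine (Submodule.eq_bot_iff _).2 ?_
    rintro _ ⟨x, hx, rfl⟩
    exact (hh x (hTP hx)).2 hx
  have hhkG : ∀ G : Submodule ℂ (Fin b → ℂ), (G.map k).map h = G := fun G => by
    rw [← Submodule.map_comp, show h ∘ₗ k = LinearMap.id from LinearMap.ext hhk, Submodule.map_id]
  refine ⟨h, k, fun G => sup_le hTP ?_, fun V hTV hVP => le_antisymm (sup_le hTV ?_) ?_,
    fun G => ?_, fun G => ?_⟩
  · rintro _ ⟨c, -, rfl⟩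
    exact hkP c
  · rintro _ ⟨_, ⟨x, hx, rfl⟩, rfl⟩
    have : x - k (h x) ∈ T :=
      (hh _ (sub_mem (hVP hx) (hkP _))).1 (by rw [map_sub, hhk, sub_self])
    simpa using sub_mem hx (hTV this)
  · intro x hx
    have : x - k (h x) ∈ T :=
      (hh _ (sub_mem (hVP hx) (hkP _))).1 (by rw [map_sub, hhk, sub_self])
    exact Submodule.mem_sup.2 ⟨_, this, k (h x), ⟨_, ⟨x, hx, rfl⟩, rfl⟩, by abel⟩
  · rw [Submodule.map_sup, hhT, hhkG, bot_sup_eq]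
  · have hd : T ⊓ G.map k = ⊥ := by
      refine (Submodule.eq_bot_iff _).2 ?_
      rintro _ ⟨hx, c, -, rfl⟩
      have := (hh _ (hkP c)).2 hx
      rw [hhk] at this
      rw [this, map_zero]
    have := Submodule.finrank_sup_add_finrank_inf_eq T (G.map k)
    rw [hd, finrank_bot, ht,
      ← (Submodule.equivMapOfInjective k (Function.LeftInverse.injective hhk) G).finrank_eq] at this
    exact this

/-- Two morphisms `T`, `P` to Grassmannians of a space `A` with `T y ≤ P y` are simultaneously
locally trivial: near `y₀` there is a regular family of automorphisms `g y` of `A` carrying `T y₀`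
to `T y` and `P y₀` to `P y`. -/
theorem exists_flag_trivialization {Y : Type v} {s : FunctionStructure Y} {A : Type u}
    [AddCommGroup A] [Module ℂ A] [FiniteDimensional ℂ A] {t p : ℕ} {T : Y → grassmannian A t}
    {P : Y → grassmannian A p} (hT : s.IsMorphism (grassmannian A t).str T)
    (hP : s.IsMorphism (grassmannian A p).str P) (hTP : ∀ y, (T y).1 ≤ (P y).1) (y₀ : Y) :
    ∃ (W : Set Y) (g g' : Y → A →ₗ[ℂ] A), s.IsOpen W ∧ y₀ ∈ W ∧
      (∀ a, s.RegularVec W fun y => g y a) ∧ (∀ a, s.RegularVec W fun y => g' y a) ∧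
      ∀ y ∈ W, g' y ∘ₗ g y = LinearMap.id ∧ g y ∘ₗ g' y = LinearMap.id ∧
        (T y₀).1.map (g y) = (T y).1 ∧ (P y₀).1.map (g y) = (P y).1 := by
  obtain ⟨U, F, hU, hyU, hF, hFT⟩ := exists_regularVec_frame hT y₀
  obtain ⟨U', G, hU', hyU', hG, hGP⟩ := exists_regularVec_frame hP y₀
  have hUU := s.isOpen_inter _ _ hU hU'
  -- Decompose `a` along the frames at `y₀`: coordinates `m₁ a` in the frame of `T y₀`, coordinates
  -- `m₂ a` of the rest in the frame of `P y₀`, and a remainder `c a`. Letting the frames vary with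
  -- the coordinates kept then moves `T y₀` into `T y` and `P y₀` into `T y + P y = P y`.
  have key : ∃ (m₁ : A →ₗ[ℂ] (Fin t → ℂ)) (m₂ : A →ₗ[ℂ] (Fin p → ℂ)) (c : A →ₗ[ℂ] A),
      (∀ a, ∑ j, m₁ a j • F j y₀ + ∑ j, m₂ a j • G j y₀ + c a = a) ∧
      (∀ a ∈ (T y₀).1, m₂ a = 0 ∧ c a = 0) ∧ ∀ a ∈ (P y₀).1, c a = 0 := by
    have aux : ∀ {d : ℕ} {Q : Submodule ℂ A} (H : Fin d → A),
        LinearIndependent ℂ H → Submodule.span ℂ (Set.range H) = Q →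
        ∃ m : A →ₗ[ℂ] (Fin d → ℂ), ∀ a ∈ Q, ∑ j, m a j • H j = a := by
      rintro d Q H hH rfl
      obtain ⟨m, hm⟩ := LinearMap.exists_extend (Module.Basis.span hH).equivFun.toLinearMap
      refine ⟨m, fun a ha => ?_⟩
      have h1 := LinearMap.congr_fun hm ⟨a, ha⟩
      simp only [LinearMap.comp_apply, Submodule.subtype_apply] at h1
      have h2 := congrArg Subtype.val ((Module.Basis.span hH).sum_equivFun ⟨a, ha⟩)
      rw [h1]
      simpa [Module.Basis.span_apply] using h2
    obtain ⟨m₁, hm₁⟩ := aux _ (hFT y₀ hyU).1 (hFT y₀ hyU).2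
    obtain ⟨m₂, hm₂⟩ := aux _ (hGP y₀ hyU').1 (hGP y₀ hyU').2
    let f : A →ₗ[ℂ] A := Fintype.linearCombination ℂ (fun j => F j y₀) ∘ₗ m₁
    have hf : ∀ a, f a = ∑ j, m₁ a j • F j y₀ := fun a => by
      simp [f, Fintype.linearCombination_apply]
    let k : A →ₗ[ℂ] A := Fintype.linearCombination ℂ (fun j => G j y₀) ∘ₗ m₂
    have hk : ∀ a, k a = ∑ j, m₂ a j • G j y₀ := fun a => by
      simp [k, Fintype.linearCombination_apply]
    have hfm : ∀ a, f a ∈ (T y₀).1 := fun a => by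
      rw [hf, ← (hFT y₀ hyU).2]
      exact sum_mem fun j _ => Submodule.smul_mem _ _ (Submodule.subset_span ⟨j, rfl⟩)
    refine ⟨m₁, m₂ ∘ₗ (LinearMap.id - f), LinearMap.id - f - k ∘ₗ (LinearMap.id - f),
      fun a => ?_, fun a ha => ?_, fun a ha => ?_⟩
    · rw [← hf]
      simp only [LinearMap.comp_apply]
      rw [← hk]
      simp
    · have : f a = a := by rw [hf, hm₁ a ha]
      simp [this]
    · have : k (a - f a) = a - f a := by
        rw [hk, hm₂ _ (sub_mem ha (hTP y₀ (hfm a)))]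
      simp only [LinearMap.sub_apply, LinearMap.comp_apply, LinearMap.id_apply]
      rw [this, sub_self]
  obtain ⟨m₁, m₂, c, hsum, hcT, hcP⟩ := key
  let g : Y → A →ₗ[ℂ] A := fun y => Fintype.linearCombination ℂ (fun j => F j y) ∘ₗ m₁ +
    Fintype.linearCombination ℂ (fun j => G j y) ∘ₗ m₂ + c
  have hg : ∀ y a, g y a = ∑ j, m₁ a j • F j y + ∑ j, m₂ a j • G j y + c a := fun y a => by
    simp [g, Fintype.linearCombination_apply]
  have hgr : ∀ a, s.RegularVec (U ∩ U') fun y => g y a := fun a => by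
    simp only [hg]
    refine ((RegularVec.sum _ hUU fun j _ => ?_).add (RegularVec.sum _ hUU fun j _ => ?_)).add
      (RegularVec.const hUU _)
    · exact ((hF j).mono hUU Set.inter_subset_left).smul (s.regular_const _ hUU)
    · exact ((hG j).mono hUU Set.inter_subset_right).smul (s.regular_const _ hUU)
  obtain ⟨W, hWU, hyW, hW, g', hg'r, hg'⟩ := RegularVec.exists_inverse hUU hgr ⟨hyU, hyU'⟩
    (LinearMap.ext fun a => by rw [hg, hsum]; rfl)
  refine ⟨W, g, g', hW, hyW, fun a => (hgr a).mono hW hWU, hg'r, fun y hy =>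
    ⟨(hg' y hy).1, (hg' y hy).2, ?_, ?_⟩⟩
  all_goals
    have hinj : Function.Injective (g y) :=
      Function.LeftInverse.injective (LinearMap.congr_fun (hg' y hy).1)
    have hFm : ∀ x : Fin t → ℂ, ∑ j, x j • F j y ∈ (T y).1 := fun x => by
      rw [← (hFT y (hWU hy).1).2]
      exact sum_mem fun j _ => Submodule.smul_mem _ _ (Submodule.subset_span ⟨j, rfl⟩)
    have hGm : ∀ x : Fin p → ℂ, ∑ j, x j • G j y ∈ (P y).1 := fun x => by
      rw [← (hGP y (hWU hy).2).2]
      exact sum_mem fun j _ => Submodule.smul_mem _ _ (Submodule.subset_span ⟨j, rfl⟩)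
    refine Submodule.eq_of_le_of_finrank_eq ?_ ?_
  · rintro _ ⟨a, ha, rfl⟩
    rw [hg, (hcT a ha).1, (hcT a ha).2]
    simpa using hFm _
  · rw [← (Submodule.equivMapOfInjective _ hinj _).finrank_eq, (T y₀).2, (T y).2]
  · rintro _ ⟨a, ha, rfl⟩
    rw [hg, hcP a ha, add_zero]
    exact add_mem (hTP y (hFm _)) (hGm _)
  · rw [← (Submodule.equivMapOfInjective _ hinj _).finrank_eq, (P y₀).2, (P y).2]

/-- A space `X` over `Y` whose points over `y` are the families of subspaces `V i` with
`T i y ≤ V i ≤ P i y`, where `T i` and `P i` are morphisms to Grassmannians, is locally trivial over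
`Y`. That `X` parametrizes these families, in the sense of spaces with functions, is expressed by
`hVTP`, `hex`, `hinj` and `hX`. -/
theorem isFibration_of_flags {X Y : SpaceWithFunctions.{u}} {I : Type} [Finite I] {A : I → Type u}
    [∀ i, AddCommGroup (A i)] [∀ i, Module ℂ (A i)] [∀ i, FiniteDimensional ℂ (A i)]
    {t p d : I → ℕ} (htd : ∀ i, t i ≤ d i) (htp : ∀ i, t i ≤ p i)
    {T : ∀ i, Y → grassmannian (A i) (t i)} {P : ∀ i, Y → grassmannian (A i) (p i)}
    (hT : ∀ i, Y.str.IsMorphism (grassmannian (A i) (t i)).str (T i))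
    (hP : ∀ i, Y.str.IsMorphism (grassmannian (A i) (p i)).str (P i))
    (hTP : ∀ i y, (T i y).1 ≤ (P i y).1)
    {q : X → Y} {V : ∀ i, X → grassmannian (A i) (d i)} (hq : X.str.IsMorphism Y.str q)
    (hV : ∀ i, X.str.IsMorphism (grassmannian (A i) (d i)).str (V i))
    (hVTP : ∀ i x, (T i (q x)).1 ≤ (V i x).1 ∧ (V i x).1 ≤ (P i (q x)).1)
    (hex : ∀ y (v : ∀ i, grassmannian (A i) (d i)),
      (∀ i, (T i y).1 ≤ (v i).1 ∧ (v i).1 ≤ (P i y).1) → ∃ x, q x = y ∧ ∀ i, V i x = v i)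
    (hinj : ∀ x x', q x = q x' → (∀ i, V i x = V i x') → x = x')
    (hX : ∀ {Z : Type u} {s : FunctionStructure Z} {φ : Z → X}, s.IsMorphism Y.str (q ∘ φ) →
      (∀ i, s.IsMorphism (grassmannian (A i) (d i)).str (V i ∘ φ)) → s.IsMorphism X.str φ) :
    IsFibration q (pi fun i => grassmannian (Fin (p i - t i) → ℂ) (d i - t i)) := by
  refine ⟨hq, fun y₀ => ?_⟩
  choose W g g' hW hyW hg hg' hgg' using fun i =>
    exists_flag_trivialization (hT i) (hP i) (hTP i) y₀
  choose h k hkP hkh hhk hdim using fun i => exists_quotient_section (hTP i y₀) (T i y₀).2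
    (b := p i - t i) (by rw [(P i y₀).2, Nat.add_sub_cancel' (htp i)])
  let F := pi fun i => grassmannian (Fin (p i - t i) → ℂ) (d i - t i)
  let W' : Set Y := ⋂ i, W i
  have hW'i : ∀ {y}, y ∈ W' → ∀ i, y ∈ W i := fun hy i => Set.mem_iInter.1 hy i
  have hginj : ∀ i, ∀ y ∈ W i, Function.Injective (g i y) := fun i y hy =>
    Function.LeftInverse.injective (LinearMap.congr_fun (hgg' i y hy).1)
  have hgg : ∀ i, ∀ y ∈ W i, ∀ B : Submodule ℂ (A i), (B.map (g i y)).map (g' i y) = B :=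
    fun i y hy B => by rw [← Submodule.map_comp, (hgg' i y hy).1, Submodule.map_id]
  have hgg₂ : ∀ i, ∀ y ∈ W i, ∀ B : Submodule ℂ (A i), (B.map (g' i y)).map (g i y) = B :=
    fun i y hy B => by rw [← Submodule.map_comp, (hgg' i y hy).2.1, Submodule.map_id]
  -- Moving the subspace `V i x` into the fixed interval `[T i y₀, P i y₀]`.
  have hV₀ : ∀ (x : X), q x ∈ W' → ∀ i, (T i y₀).1 ⊔
      (((V i x).1.map (g' i (q x))).map (h i)).map (k i) = (V i x).1.map (g' i (q x)) :=
    fun x hx i => by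
      refine hkh i _ ?_ ?_
      · rw [← hgg i _ (hW'i hx i) (T i y₀).1, (hgg' i _ (hW'i hx i)).2.2.1]
        exact Submodule.map_mono (hVTP i x).1
      · rw [← hgg i _ (hW'i hx i) (P i y₀).1, (hgg' i _ (hW'i hx i)).2.2.2]
        exact Submodule.map_mono (hVTP i x).2
  let triv : X.sub (q ⁻¹' W') → (Y.sub W').prod F := fun x =>
    (⟨q x.1, x.2⟩, fun i => ⟨((V i x.1).1.map (g' i (q x.1))).map (h i), by
      have h1 := hdim i (((V i x.1).1.map (g' i (q x.1))).map (h i))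
      have h2 : Module.finrank ℂ ((V i x.1).1.map (g' i (q x.1))) = d i := by
        exact (Submodule.equivMapOfInjective _ (Function.LeftInverse.injective (LinearMap.congr_fun
          (hgg' i _ (hW'i x.2 i)).2.1)) _).finrank_eq.symm.trans (V i x.1).2
      rw [hV₀ x.1 x.2 i, h2] at h1
      omega⟩)
  let v : ∀ (z : (Y.sub W').prod F) (i), grassmannian (A i) (d i) := fun z i =>
    ⟨((T i y₀).1 ⊔ (z.2 i).1.map (k i)).map (g i z.1.1), by
      rw [← (Submodule.equivMapOfInjective _ (hginj i _ (hW'i z.1.2 i)) _).finrank_eq, hdim,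
        (z.2 i).2]
      exact Nat.add_sub_cancel' (htd i)⟩
  have hv : ∀ z i, (T i z.1.1).1 ≤ (v z i).1 ∧ (v z i).1 ≤ (P i z.1.1).1 := fun z i => by
    rw [← (hgg' i _ (hW'i z.1.2 i)).2.2.1, ← (hgg' i _ (hW'i z.1.2 i)).2.2.2]
    exact ⟨Submodule.map_mono le_sup_left, Submodule.map_mono (hkP i _)⟩
  choose inv hinvq hinvV using fun z => hex z.1.1 (v z) (hv z)
  refine ⟨W', isOpen_iInter hW, Set.mem_iInter.2 hyW,
    { toFun := triv
      invFun := fun z => ⟨inv z, by rw [Set.mem_preimage, hinvq]; exact z.1.2⟩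
      left_inv := fun x => Subtype.ext (hinj _ _ (hinvq _) fun i => Subtype.ext ?_)
      right_inv := fun z => Prod.ext (Subtype.ext (hinvq z)) (funext fun i => Subtype.ext ?_)
      isMorphism_toFun := isMorphism_prod (isMorphism_sub (hq.comp isMorphism_val))
        (isMorphism_pi fun i => isMorphism_grassmannian fun x₀ => ?_)
      isMorphism_invFun := isMorphism_sub (hX ?_ fun i => isMorphism_grassmannian fun z₀ => ?_) },
    fun _ => rfl⟩
  · rw [hinvV]
    change ((T i y₀).1 ⊔ (((V i x.1).1.map (g' i (q x.1))).map (h i)).map (k i)).map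
      (g i (q x.1)) = (V i x.1).1
    rw [hV₀ x.1 x.2, hgg₂ i _ (hW'i x.2 i)]
  · change ((V i (inv z)).1.map (g' i (q (inv z)))).map (h i) = (z.2 i).1
    rw [hinvq, hinvV, hgg i _ (hW'i z.1.2 i), hhk]
  · obtain ⟨U, E, hU, hxU, hE, hEV⟩ := exists_regularVec_frame ((hV i).comp isMorphism_val) x₀
    have hg'' := fun a => (hg' i a).comp (hq.comp (isMorphism_val (S := q ⁻¹' W')))
    have hUU := (X.sub (q ⁻¹' W')).str.isOpen_inter _ _ hU (hg'' 0).1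
    refine ⟨_, Fin (d i), fun j x => h i (g' i (q x.1) (E j x)), hUU, ⟨hxU, hW'i x₀.2 i⟩,
      fun j => (RegularVec.apply (fun a => (hg'' a).mono hUU Set.inter_subset_right)
        ((hE j).mono hUU Set.inter_subset_left)).linearMap (h i), fun x hx => ?_⟩
    change _ = ((V i x.1).1.map (g' i (q x.1))).map (h i)
    have := (hEV x hx.1).2
    simp only [Function.comp_apply] at this
    rw [← this, Submodule.map_span, Submodule.map_span, ← Set.range_comp, ← Set.range_comp]
    rfl
  · have : q ∘ inv = fun z => z.1.1 := funext hinvq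
    change FunctionStructure.IsMorphism _ _ (q ∘ inv)
    rw [this]
    exact isMorphism_val.comp isMorphism_fst
  · have hp₁ : ((Y.sub W').prod F).str.IsMorphism Y.str fun z => z.1.1 :=
      isMorphism_val.comp isMorphism_fst
    have hp₂ : ((Y.sub W').prod F).str.IsMorphism (grassmannian _ _).str fun z => z.2 i :=
      (isMorphism_eval i).comp isMorphism_snd
    obtain ⟨U, E, hU, hzU, hE, hEV⟩ := exists_regularVec_frame hp₂ z₀
    have hg'' := fun a => (hg i a).comp hp₁
    have hUU := ((Y.sub W').prod F).str.isOpen_inter _ _ hU (hg'' 0).1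
    obtain ⟨m, b, hb⟩ := Submodule.fg_iff_exists_fin_generating_family.1
      (IsNoetherian.noetherian (T i y₀).1)
    refine ⟨_, Fin m ⊕ Fin (d i - t i), fun j z => g i z.1.1
      (Sum.elim b (fun j => k i (E j z)) j), hUU, ⟨hzU, hW'i z₀.1.2 i⟩,
      fun j => RegularVec.apply (fun a => (hg'' a).mono hUU Set.inter_subset_right) ?_,
      fun z hz => ?_⟩
    · rcases j with j | j
      · exact RegularVec.const hUU _
      · exact ((hE j).mono hUU Set.inter_subset_left).linearMap (k i)
    · change _ = (V i (inv z)).1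
      rw [hinvV]
      change _ = ((T i y₀).1 ⊔ (z.2 i).1.map (k i)).map (g i z.1.1)
      rw [← hb, ← (hEV z hz.1).2, Submodule.map_span, ← Set.range_comp, ← Submodule.span_union,
        ← Set.Sum.elim_range, Submodule.map_span, ← Set.range_comp]
      rfl

end SpaceWithFunctions

/-! ### Truncated quiver Grassmannians of the cylinder -/

theorem Submodule.finrank_comap_of_surjective {V V' : Type*} [AddCommGroup V] [Module ℂ V]
    [FiniteDimensional ℂ V] [AddCommGroup V'] [Module ℂ V'] {f : V →ₗ[ℂ] V'}
    (hf : Function.Surjective f) (U : Submodule ℂ V') :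
    Module.finrank ℂ (U.comap f) = Module.finrank ℂ (LinearMap.ker f) + Module.finrank ℂ U := by
  let g : U.comap f →ₗ[ℂ] U := f.restrict fun _ hx => hx
  have hg : LinearMap.range g = ⊤ := LinearMap.range_eq_top.2 fun y => by
    obtain ⟨x, hx⟩ := hf y.1
    exact ⟨⟨x, by rw [Submodule.mem_comap, hx]; exact y.2⟩, Subtype.ext hx⟩
  have hk : LinearMap.ker g = (LinearMap.ker f).comap (U.comap f).subtype := by
    ext x
    exact Subtype.ext_iff
  have hle : LinearMap.ker f ≤ U.comap f := fun x hx => by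
    rw [Submodule.mem_comap, LinearMap.mem_ker.1 hx]; exact zero_mem _
  have := g.finrank_range_add_finrank_ker
  rw [hg, finrank_top, hk, (Submodule.comapSubtypeEquivOfLe hle).finrank_eq] at this
  omega

namespace CylinderQuiver

variable {n N : ℕ}

/-- The vertex `(i, k)`, with heights `k` counted from `0`. -/
def vertex (i : CycleQuiver n) (k : ℕ) (h : k < N) : CylinderQuiver n N := (i, ⟨k, h⟩)

theorem eq_of_level_le {k : ℕ} (w : CylinderQuiver n N) (hw : k ≤ w.2.1) :
    k + 1 ≤ w.2.1 ∨ ∃ (i : CycleQuiver n) (hk : k < N), w = vertex (i + 1) k hk := by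
  obtain ⟨j, l, hl⟩ := w
  rcases Nat.lt_or_ge k l with h | h
  · exact Or.inl h
  · obtain rfl : l = k := le_antisymm h hw
    exact Or.inr ⟨j - 1, hl, by rw [sub_add_cancel]; rfl⟩

end CylinderQuiver

namespace QuiverRep

open SpaceWithFunctions FunctionStructure

variable {n N : ℕ} (L : QuiverRep.{u} (CylinderQuiver n N)) (d : CylinderQuiver n N → ℕ)

/-- The action of the arrow `α` from `(i, k)` to `(i, k + 1)`. -/
def up (i : CycleQuiver n) (k : ℕ) (h : k + 1 < N) :
    L.V (.vertex i k (k.lt_succ_self.trans h)) →ₗ[ℂ] L.V (.vertex i (k + 1) h) :=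
  L.map (CylinderQuiver.Arrow.α i k h)

/-- The action of the arrow `β` from `(i, k + 1)` to `(i + 1, k)`. -/
def down (i : CycleQuiver n) (k : ℕ) (h : k + 1 < N) :
    L.V (.vertex i (k + 1) h) →ₗ[ℂ] L.V (.vertex (i + 1) k (k.lt_succ_self.trans h)) :=
  L.map (CylinderQuiver.Arrow.β i k h)

/-- The truncation of the quiver Grassmannian of a representation of the cylinder to the vertices
`(i, l)` with `k ≤ l`. -/
def truncatedGrassmannian (k : ℕ) : SpaceWithFunctions.{u} :=
  (SpaceWithFunctions.pi fun v : {v : CylinderQuiver n N // k ≤ v.2.1} =>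
    SpaceWithFunctions.grassmannian (L.V v.1) (d v.1)).sub
    {U | ∀ (v w : {v : CylinderQuiver n N // k ≤ v.2.1}) (a : v.1 ⟶ w.1),
      ∀ x ∈ (U v).1, L.map a x ∈ (U w).1}

theorem isMorphism_truncatedGrassmannian_eval (k : ℕ) (v : {v : CylinderQuiver n N // k ≤ v.2.1}) :
    (L.truncatedGrassmannian d k).str.IsMorphism
      (SpaceWithFunctions.grassmannian (L.V v.1) (d v.1)).str fun U => U.1 v :=
  (isMorphism_eval v).comp isMorphism_val

theorem isProjectiveVariety_truncatedGrassmannian [NeZero n] (k : ℕ) :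
    (L.truncatedGrassmannian d k).IsProjectiveVariety := by
  have : Finite (CylinderQuiver n N) := inferInstanceAs (Finite (ZMod n × Fin N))
  refine isProjectiveVariety_sub_pi _ _ _ (isOpen_of_locally fun U hU => ?_)
  simp only [Set.mem_compl_iff, Set.mem_ofPred_eq, not_forall] at hU
  obtain ⟨v, w, a, x, hx, hxw⟩ := hU
  exact ⟨{U | ∀ x ∈ (U v).1, L.map a x ∈ (U w).1}ᶜ, fun U' hU' h => hU' (h v w a), fun h =>
    hxw (h x hx), isOpen_compl_map_le (L.map a) (isMorphism_eval v) (isMorphism_eval w)⟩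

/-- Without truncation, one gets the quiver Grassmannian. -/
def truncatedGrassmannianZero : Iso (L.truncatedGrassmannian d 0) (L.grassmannian d) where
  toFun U := ⟨fun v => U.1 ⟨v, Nat.zero_le _⟩, fun _ _ a =>
    U.2 ⟨_, Nat.zero_le _⟩ ⟨_, Nat.zero_le _⟩ a⟩
  invFun U := ⟨fun v => U.1 v.1, fun _ _ a => U.2 _ _ a⟩
  left_inv _ := rfl
  right_inv _ := rfl
  isMorphism_toFun := isMorphism_sub (isMorphism_pi fun v =>
    L.isMorphism_truncatedGrassmannian_eval d 0 ⟨v, Nat.zero_le _⟩)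
  isMorphism_invFun := isMorphism_sub (isMorphism_pi fun v =>
    (isMorphism_eval v.1).comp isMorphism_val)

/-- As there are no arrows inside the top layer, the truncation to it is a product of
Grassmannians. -/
noncomputable def truncatedGrassmannianTop (hN : 1 ≤ N) :
    Iso (L.truncatedGrassmannian d (N - 1))
      (SpaceWithFunctions.pi fun i : CycleQuiver n => SpaceWithFunctions.grassmannian
        (Fin (L.dim (.vertex i (N - 1) (Nat.sub_lt hN Nat.one_pos))) → ℂ)
        (d (.vertex i (N - 1) (Nat.sub_lt hN Nat.one_pos)))) :=
  (Iso.subUniv _ (by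
    rintro U ⟨v, hv⟩ ⟨w, hw⟩ a
    change CylinderQuiver.Arrow n N v w at a
    cases a with
    | α i k h => exact absurd (show N - 1 ≤ k from hv) (by omega)
    | β i k h => exact absurd (show N - 1 ≤ k from hw) (by omega))).trans
  (Iso.piCongr
    (X := fun i => SpaceWithFunctions.grassmannian (Fin (L.dim (.vertex i (N - 1)
      (Nat.sub_lt hN Nat.one_pos))) → ℂ) (d (.vertex i (N - 1) (Nat.sub_lt hN Nat.one_pos))))
    (Y := fun v : {v : CylinderQuiver n N // N - 1 ≤ v.2.1} =>
      SpaceWithFunctions.grassmannian (L.V v.1) (d v.1))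
    { toFun := fun i => ⟨.vertex i (N - 1) (Nat.sub_lt hN Nat.one_pos), le_rfl⟩
      invFun := fun v => v.1.1
      left_inv := fun _ => rfl
      right_inv := by
        rintro ⟨⟨i, l, hl⟩, h⟩
        obtain rfl : l = N - 1 := le_antisymm (Nat.le_sub_one_of_lt hl) h
        rfl }
    fun i => Iso.grassmannianCongr (LinearEquiv.ofFinrankEq _ _
      (by rw [Module.finrank_fin_fun]; rfl)) rfl).symm

/-- Forgetting the layer of height `k`. -/
def forgetLayer (k : ℕ) (U : L.truncatedGrassmannian d k) : L.truncatedGrassmannian d (k + 1) :=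
  ⟨fun v => U.1 ⟨v.1, (Nat.le_succ k).trans v.2⟩, fun v w a =>
    U.2 ⟨v.1, (Nat.le_succ k).trans v.2⟩ ⟨w.1, (Nat.le_succ k).trans w.2⟩ a⟩

/-- Given the layers above height `k`, the subspace at the vertex `(i + 1, k)` can be any subspace
between the image of the one at `(i, k + 1)` and the preimage of the one at `(i + 1, k + 1)`. The
dimension of the former is constant as `β` is injective, and that of the latter is constant as `α`
is surjective. The hypothesis `hrel` yields the inclusion of the former in the latter. -/
theorem isFibration_forgetLayer [NeZero n]
    (hup : ∀ i k h, Function.Surjective (L.up i k h))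
    (hdown : ∀ i k h, Function.Injective (L.down i k h))
    (hrel : ∀ i k h (x : L.V (.vertex i (k + 1) h)), L.up (i + 1) k h (L.down i k h x) = 0 ∨
      ∃ h', L.up (i + 1) k h (L.down i k h x) = L.down i (k + 1) h' (L.up i (k + 1) h' x))
    {k : ℕ} (h : k + 1 < N)
    (hd : ∀ i, d (.vertex i (k + 1) h) ≤ d (.vertex (i + 1) k (k.lt_succ_self.trans h)))
    (hd' : ∀ i, d (.vertex i k (k.lt_succ_self.trans h)) ≤
      Module.finrank ℂ (LinearMap.ker (L.up i k h)) + d (.vertex i (k + 1) h)) :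
    ∃ (r s : CycleQuiver n → ℕ), (∀ i, r i ≤ s i) ∧
      IsFibration (L.forgetLayer d k)
        (SpaceWithFunctions.pi fun i => SpaceWithFunctions.grassmannian (Fin (s i) → ℂ) (r i)) := by
  have : Finite (CycleQuiver n) := inferInstanceAs (Finite (ZMod n))
  have hk := k.lt_succ_self.trans h
  let T : ∀ i, L.truncatedGrassmannian d (k + 1) →
      SpaceWithFunctions.grassmannian (L.V (.vertex (i + 1) k hk)) (d (.vertex i (k + 1) h)) :=
    fun i y => ⟨(y.1 ⟨.vertex i (k + 1) h, le_rfl⟩).1.map (L.down i k h),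
      (Submodule.equivMapOfInjective _ (hdown i k h) _).finrank_eq.symm.trans
        (y.1 ⟨.vertex i (k + 1) h, le_rfl⟩).2⟩
  let P : ∀ i, L.truncatedGrassmannian d (k + 1) →
      SpaceWithFunctions.grassmannian (L.V (.vertex (i + 1) k hk))
        (Module.finrank ℂ (LinearMap.ker (L.up (i + 1) k h)) + d (.vertex (i + 1) (k + 1) h)) :=
    fun i y => ⟨(y.1 ⟨.vertex (i + 1) (k + 1) h, le_rfl⟩).1.comap (L.up (i + 1) k h),
      (Submodule.finrank_comap_of_surjective (hup (i + 1) k h) _).trans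
        (congrArg _ (y.1 ⟨.vertex (i + 1) (k + 1) h, le_rfl⟩).2)⟩
  refine ⟨fun i => d (.vertex (i + 1) k hk) - d (.vertex i (k + 1) h), fun i =>
    Module.finrank ℂ (LinearMap.ker (L.up (i + 1) k h)) + d (.vertex (i + 1) (k + 1) h) -
      d (.vertex i (k + 1) h), fun i => Nat.sub_le_sub_right (hd' (i + 1)) _,
    isFibration_of_flags (T := T) (P := P) (V := fun i U => U.1 ⟨.vertex (i + 1) k hk, le_rfl⟩) hd
      (fun i => (hd i).trans (hd' (i + 1)))
      (fun i => isMorphism_map (L.down i k h) (L.isMorphism_truncatedGrassmannian_eval d (k + 1)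
        ⟨.vertex i (k + 1) h, le_rfl⟩) fun _ => rfl)
      (fun i => isMorphism_comap (L.up (i + 1) k h) (hup (i + 1) k h)
        (L.isMorphism_truncatedGrassmannian_eval d (k + 1)
          ⟨.vertex (i + 1) (k + 1) h, le_rfl⟩) fun _ => rfl)
      ?_ (isMorphism_sub (isMorphism_pi fun v => L.isMorphism_truncatedGrassmannian_eval d k
        ⟨v.1, (Nat.le_succ k).trans v.2⟩))
      (fun i => L.isMorphism_truncatedGrassmannian_eval d k ⟨.vertex (i + 1) k hk, le_rfl⟩)
      ?_ ?_ ?_ ?_⟩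
  · rintro i y _ ⟨x, hx, rfl⟩
    change L.up (i + 1) k h (L.down i k h x) ∈ (y.1 ⟨.vertex (i + 1) (k + 1) h, le_rfl⟩).1
    rcases hrel i k h x with h0 | ⟨h', h0⟩
    · rw [h0]; exact zero_mem _
    · rw [h0]
      exact y.2 ⟨.vertex i (k + 2) h', Nat.le_succ _⟩ ⟨.vertex (i + 1) (k + 1) h, le_rfl⟩
        (CylinderQuiver.Arrow.β i (k + 1) h') _
        (y.2 ⟨.vertex i (k + 1) h, le_rfl⟩ ⟨.vertex i (k + 2) h', Nat.le_succ _⟩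
          (CylinderQuiver.Arrow.α i (k + 1) h') x hx)
  · intro i U
    constructor
    · rintro _ ⟨x, hx, rfl⟩
      exact U.2 ⟨.vertex i (k + 1) h, Nat.le_succ k⟩ ⟨.vertex (i + 1) k hk, le_rfl⟩
        (CylinderQuiver.Arrow.β i k h) x hx
    · exact fun x hx => U.2 ⟨.vertex (i + 1) k hk, le_rfl⟩
        ⟨.vertex (i + 1) (k + 1) h, Nat.le_succ k⟩
        (CylinderQuiver.Arrow.α (i + 1) k h) x hx
  · intro y v hv
    have hex : ∀ w : {w : CylinderQuiver n N // k ≤ w.2.1},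
        ∃ u : SpaceWithFunctions.grassmannian (L.V w.1) (d w.1),
          (∀ hw : k + 1 ≤ w.1.2.1, u = y.1 ⟨w.1, hw⟩) ∧
          ∀ i, w.1 = .vertex (i + 1) k hk → HEq u (v i) := by
      rintro ⟨w, hw⟩
      rcases CylinderQuiver.eq_of_level_le w hw with hw' | ⟨i, -, rfl⟩
      · refine ⟨y.1 ⟨w, hw'⟩, fun _ => rfl, fun i hi => ?_⟩
        change w = _ at hi
        subst hi
        exact absurd hw' (Nat.not_succ_le_self k)
      · refine ⟨v i, fun hw' => absurd hw' (Nat.not_succ_le_self k), fun j hj => ?_⟩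
        obtain rfl : i = j := add_right_cancel (congrArg Prod.fst hj)
        rfl
    choose U hU hU' using hex
    have hUk : ∀ i, U ⟨.vertex (i + 1) k hk, le_rfl⟩ = v i := fun i => eq_of_heq (hU' _ i rfl)
    refine ⟨⟨U, ?_⟩, Subtype.ext (funext fun w => hU _ w.2), hUk⟩
    rintro ⟨w, hw⟩ ⟨w', hw'⟩ a x hx
    change CylinderQuiver.Arrow n N w w' at a
    cases a with
    | α j l hl =>
      rcases CylinderQuiver.eq_of_level_le _ hw with hw₁ | ⟨i, _, hi⟩
      · rw [hU _ hw₁] at hx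
        rw [hU _ (Nat.le_succ_of_le hw₁)]
        exact y.2 ⟨.vertex j l (l.lt_succ_self.trans hl), hw₁⟩
          ⟨.vertex j (l + 1) hl, Nat.le_succ_of_le hw₁⟩ (CylinderQuiver.Arrow.α j l hl) x hx
      · cases hi
        replace hx : x ∈ (U ⟨.vertex (i + 1) k hk, le_rfl⟩).1 := hx
        rw [hUk] at hx
        rw [hU _ le_rfl]
        exact (hv i).2 hx
    | β j l hl =>
      rcases CylinderQuiver.eq_of_level_le _ hw' with hw₁ | ⟨i, _, hi⟩
      · rw [hU _ (Nat.le_succ_of_le hw₁)] at hx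
        rw [hU _ hw₁]
        exact y.2 ⟨.vertex j (l + 1) hl, Nat.le_succ_of_le hw₁⟩
          ⟨.vertex (j + 1) l (l.lt_succ_self.trans hl), hw₁⟩ (CylinderQuiver.Arrow.β j l hl) x hx
      · obtain rfl : j = i := add_right_cancel (congrArg Prod.fst hi)
        obtain rfl : l = k := congrArg (fun v => v.2.1) hi
        rw [hU _ le_rfl] at hx
        change _ ∈ (U ⟨.vertex (j + 1) l hk, le_rfl⟩).1
        rw [hUk]
        exact (hv j).1 ⟨x, hx, rfl⟩
  · intro U U' he hV
    refine Subtype.ext (funext ?_)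
    rintro ⟨w, hw⟩
    rcases CylinderQuiver.eq_of_level_le w hw with hw' | ⟨i, -, rfl⟩
    · exact congrFun (congrArg Subtype.val he) ⟨w, hw'⟩
    · exact hV i
  · intro Z s φ hq hV
    refine isMorphism_sub (isMorphism_pi ?_)
    rintro ⟨w, hw⟩
    rcases CylinderQuiver.eq_of_level_le w hw with hw' | ⟨i, -, rfl⟩
    · exact (L.isMorphism_truncatedGrassmannian_eval d _ ⟨w, hw'⟩).comp hq
    · exact hV i

end QuiverRep

/-! ### The representation of the cylinder attached to a nilpotent representation -/

namespace QuiverRep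

open SpaceWithFunctions

variable {n N : ℕ}

theorem idMap_injective (M : QuiverRep.{u} (CycleQuiver n)) {i j : CycleQuiver n} (h : i = j) :
    Function.Injective (M.idMap h) := by
  subst h; exact Function.injective_id

theorem hat_up_surjective (M : QuiverRep.{u} (CycleQuiver n)) (i : CycleQuiver n) (k : ℕ)
    (h : k + 1 < N) : Function.Surjective ((M.hat N).up i k h) := by
  rintro ⟨_, x, rfl⟩
  exact ⟨⟨_, x, rfl⟩, rfl⟩

theorem hat_down_injective (M : QuiverRep.{u} (CycleQuiver n)) (i : CycleQuiver n) (k : ℕ)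
    (h : k + 1 < N) : Function.Injective ((M.hat N).down i k h) := fun _ _ hxy =>
  Subtype.ext (M.idMap_injective (CycleQuiver.shift_succ i k) (congrArg Subtype.val hxy))

theorem hat_up_down (M : QuiverRep.{u} (CycleQuiver n)) (hM : M.IsNilpotent N) (i : CycleQuiver n)
    (k : ℕ) (h : k + 1 < N) (x : (M.hat N).V (.vertex i (k + 1) h)) :
    (M.hat N).up (i + 1) k h ((M.hat N).down i k h x) = 0 ∨
      ∃ h', (M.hat N).up (i + 1) k h ((M.hat N).down i k h x) =
        (M.hat N).down i (k + 1) h' ((M.hat N).up i (k + 1) h' x) := by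
  have key : ((M.hat N).up (i + 1) k h ((M.hat N).down i k h x)).1 =
      M.idMap (CycleQuiver.shift_succ i (k + 1)) (M.map (CycleQuiver.arrow _) x.1) :=
    (M.idMap_map_arrow (CycleQuiver.shift_succ i k) _ x.1).symm
  by_cases h' : k + 1 + 1 < N
  · exact Or.inr ⟨h', Subtype.ext key⟩
  · left
    refine Subtype.ext (key.trans ?_)
    obtain ⟨_, y, rfl⟩ := x
    have h0 := hM _ _ (CycleQuiver.path i (k + 2)) (by
      have : ∀ k, (CycleQuiver.path i k).length = k := fun k => by
        induction k with
        | zero => rfl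
        | succ k ih => exact congrArg (· + 1) ih
      rw [this]; omega)
    have h1 : M.map (CycleQuiver.arrow _) (M.pathMap (CycleQuiver.path i (k + 1)) y) = 0 :=
      LinearMap.congr_fun h0 y
    change M.idMap _ (M.map (CycleQuiver.arrow _) (M.pathMap (CycleQuiver.path i (k + 1)) y)) = 0
    rw [h1, map_zero]

theorem map_pathMap {M R : QuiverRep.{u} (CycleQuiver n)} {f : ∀ i, R.V i →ₗ[ℂ] M.V i}
    (hf : ∀ (i j : CycleQuiver n) (a : i ⟶ j) (x : R.V i), f j (R.map a x) = M.map a (f i x))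
    {i j : CycleQuiver n} (p : Quiver.Path i j) (x : R.V i) :
    f j (R.pathMap p x) = M.pathMap p (f i x) := by
  induction p with
  | nil => rfl
  | cons p a ih =>
    change f _ (R.map a (R.pathMap p x)) = M.map a (M.pathMap p (f i x))
    rw [hf, ih]

theorem hat_dim_down_le (R : QuiverRep.{u} (CycleQuiver n)) (i : CycleQuiver n) {k : ℕ}
    (h : k + 1 < N) : (R.hat N).dim (.vertex i (k + 1) h) ≤
      (R.hat N).dim (.vertex (i + 1) k (k.lt_succ_self.trans h)) :=
  LinearMap.finrank_le_finrank_of_injective (R.hat_down_injective i k h)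

/-- If `R` embeds into `M`, the kernels of the arrows `α` on the representation attached to `R`
embed into those for `M`. -/
theorem hat_dim_le_up {M R : QuiverRep.{u} (CycleQuiver n)} {f : ∀ i, R.V i →ₗ[ℂ] M.V i}
    (hf : ∀ (i j : CycleQuiver n) (a : i ⟶ j) (x : R.V i), f j (R.map a x) = M.map a (f i x))
    (hinj : ∀ i, Function.Injective (f i)) (i : CycleQuiver n) {k : ℕ} (h : k + 1 < N) :
    (R.hat N).dim (.vertex i k (k.lt_succ_self.trans h)) ≤
      Module.finrank ℂ (LinearMap.ker ((M.hat N).up i k h)) +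
        (R.hat N).dim (.vertex i (k + 1) h) := by
  have hr := ((R.hat N).up i k h).finrank_range_add_finrank_ker
  rw [LinearMap.range_eq_top.2 (R.hat_up_surjective i k h), finrank_top] at hr
  let g : (R.hat N).V (.vertex i k (k.lt_succ_self.trans h)) →ₗ[ℂ]
      (M.hat N).V (.vertex i k (k.lt_succ_self.trans h)) :=
    (f (CycleQuiver.shift i k)).restrict (by
      rintro _ ⟨x, rfl⟩
      exact ⟨f i x, (map_pathMap hf _ x).symm⟩)
  have hg : Function.Injective g := fun x y hxy =>
    Subtype.ext (hinj _ (congrArg Subtype.val hxy))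
  have hgk : ∀ x ∈ LinearMap.ker ((R.hat N).up i k h), g x ∈ LinearMap.ker ((M.hat N).up i k h) := by
    intro x hx
    refine LinearMap.mem_ker.2 (Subtype.ext ?_)
    have hx' : R.map (CycleQuiver.arrow (CycleQuiver.shift i k)) x.1 = 0 :=
      congrArg Subtype.val (show (R.hat N).up i k h x = 0 from hx)
    exact (hf _ _ (CycleQuiver.arrow (CycleQuiver.shift i k)) x.1).symm.trans
      ((congrArg (f _) hx').trans (map_zero _))
  have hle : Module.finrank ℂ (LinearMap.ker ((R.hat N).up i k h)) ≤
      Module.finrank ℂ (LinearMap.ker ((M.hat N).up i k h)) :=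
    LinearMap.finrank_le_finrank_of_injective (f := g.restrict hgk) fun x y hxy =>
      Subtype.ext (hg (congrArg Subtype.val hxy))
  unfold dim
  omega

end QuiverRep

theorem mainTheorem2 (n N : ℕ) [NeZero n] (hN : 1 ≤ N)
    (M : QuiverRep.{u} (CycleQuiver n)) (hM : M.IsNilpotent N)
    (e : CycleQuiver n → ℕ) (R : QuiverRep.{u} (CycleQuiver n))
    (hR : M.IsGenericSubrepType e R) :
    ∃ X : ℕ → SpaceWithFunctions.{u},
      (∀ k, 1 ≤ k → k ≤ N → (X k).IsProjectiveVariety) ∧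
      Nonempty (SpaceWithFunctions.Iso (X 1) ((M.hat N).grassmannian (R.hat N).dim)) ∧
      Nonempty (SpaceWithFunctions.Iso (X N)
        (SpaceWithFunctions.pi fun i : CycleQuiver n =>
          SpaceWithFunctions.grassmannian
            (Fin ((M.hat N).dim (i, ⟨N - 1, Nat.sub_lt hN Nat.one_pos⟩)) → ℂ)
            ((R.hat N).dim (i, ⟨N - 1, Nat.sub_lt hN Nat.one_pos⟩)))) ∧
      ∀ k, 1 ≤ k → k < N →
        ∃ (p : X k → X (k + 1)) (r s : CycleQuiver n → ℕ), (∀ i, r i ≤ s i) ∧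
          SpaceWithFunctions.IsFibration p
            (SpaceWithFunctions.pi fun i : CycleQuiver n =>
              SpaceWithFunctions.grassmannian (Fin (s i) → ℂ) (r i)) := by
  -- A point of the stratum gives an embedding `f` of `R` into `M`.
  obtain ⟨⟨U, φ, hφ⟩, -⟩ := hR
  let f : ∀ i, R.V i →ₗ[ℂ] M.V i := fun i => (U.1 i).1.subtype ∘ₗ (φ i).symm.toLinearMap
  have hf : ∀ (i j : CycleQuiver n) (a : i ⟶ j) (x : R.V i),
      f j (R.map a x) = M.map a (f i x) := by
    intro i j a x
    have h := hφ i j a ((φ i).symm x)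
    rw [LinearEquiv.apply_symm_apply, ← LinearEquiv.eq_symm_apply] at h
    exact congrArg Subtype.val h.symm
  have hinj : ∀ i, Function.Injective (f i) := fun i =>
    Subtype.val_injective.comp (φ i).symm.injective
  refine ⟨fun k => (M.hat N).truncatedGrassmannian (R.hat N).dim (k - 1),
    fun k _ _ => (M.hat N).isProjectiveVariety_truncatedGrassmannian _ _,
    ⟨(M.hat N).truncatedGrassmannianZero _⟩, ⟨(M.hat N).truncatedGrassmannianTop _ hN⟩,
    fun k hk hkN => ?_⟩
  obtain ⟨k, rfl⟩ : ∃ l, k = l + 1 := ⟨k - 1, by omega⟩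
  exact ⟨_, (M.hat N).isFibration_forgetLayer (R.hat N).dim
    (fun i k h => M.hat_up_surjective i k h)
    (fun i k h => M.hat_down_injective i k h) (fun i k h x => M.hat_up_down hM i k h x) hkN
    (fun i => R.hat_dim_down_le i hkN) (fun i => QuiverRep.hat_dim_le_up hf hinj i hkN)⟩
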